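/- Let $d\ge 1$ and let $\Omega$ be either a bounded open subset of $\mathbb{R}^d$ with $C^\infty$ boundary or $\Omega=\mathbb{R}^d$. Let $\varphi:[0,+\infty)\to[0,+\infty)$ be continuous except at finitely many points of $(0,+\infty)$, where it has a left and a right limit, with $\varphi(0)=0$ and $\varphi(t)=\min\{\varphi(t+),\varphi(t-)\}$ for all $t>0$. Assume that $\varphi\in\mathcal{A}$, that is: $\varphi(t)\le a t^2$ on $[0,1]$ for some constant $a>0$; $\varphi\le b$ on $[0,+\infty)$ for some constant $b>0$; $\varphi$ is non-decreasing; and $$\gamma_d\int_0^\infty \varphi(t)\,t^{-2}\,dt=1,\qquad \gamma_d:=\int_{\mathbb{S}^{d-1}}|\sigma\cdot e|\,d\sigma\quad\text{for some } e\in\mathbb{S}^{d-1}.$$ For measurable $u:\Omega\to\mathbb{R}$ and $\delta>0$ put $$\Lambda(u)=\int_\Omega\int_\Omega\frac{\varphi(|u(x)-u(y)|)}{|x-y|^{d+1}}\,dx\,dy,\qquad \Lambda_\delta(u)=\delta\,\Lambda(u/\delta).$$ Let $(\delta_n)$ be a sequence of positive numbers with $\delta_n\to0$, and let $(u_n)$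 be a bounded sequence in $L^1(\Omega)$ such that $\sup_n\Lambda_{\delta_n}(u_n)<+\infty$. Then there exist a subsequence $(u_{n_k})$ of $(u_n)$ and $u\in L^1(\Omega)$ such that $(u_{n_k})$ converges to $u$ in $L^1(\Omega)$ if $\Omega$ is bounded, respectively in $L^1_{\mathrm{loc}}(\mathbb{R}^d)$ if $\Omega=\mathbb{R}^d$. -/

import Mathlib

open MeasureTheory Set Filter Topology
open scoped NNReal ENNReal ContDiff

/-- An open subset `Ω` of `ℝ^d` with `C^∞` boundary: near each boundary point, `Ω` is the region
strictly above the graph of a smooth function, the "vertical" direction being a unit vector `e`.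
The point `z - ⟪e, z⟫ e` is the orthogonal projection of `z` onto the hyperplane `e^⊥`, so only the
values of `γ` on that hyperplane matter. -/
structure IsSmoothOpen {d : ℕ} (Ω : Set (EuclideanSpace ℝ (Fin d))) : Prop where
  isOpen : IsOpen Ω
  graph : ∀ x ∈ frontier Ω, ∃ r : ℝ, 0 < r ∧
    ∃ (e : EuclideanSpace ℝ (Fin d)) (γ : EuclideanSpace ℝ (Fin d) → ℝ),
      ‖e‖ = 1 ∧ ContDiff ℝ ∞ γ ∧
      ∀ z ∈ Metric.ball x r, z ∈ Ω ↔ γ (z - inner ℝ e z • e) < inner ℝ e z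

/-- The constant `γ_d = ∫_{S^{d-1}} |σ ⋅ e| dσ` for a unit vector `e` (`dσ` is the surface measure
of the unit sphere); by rotation invariance its value does not depend on `e`. -/
noncomputable def gammaConst {d : ℕ} (e : Metric.sphere (0 : EuclideanSpace ℝ (Fin d)) 1) :
    ℝ≥0∞ :=
  ∫⁻ σ : Metric.sphere (0 : EuclideanSpace ℝ (Fin d)) 1,
    ENNReal.ofReal |inner ℝ (σ : EuclideanSpace ℝ (Fin d)) (e : EuclideanSpace ℝ (Fin d))|
      ∂(volume : Measure (EuclideanSpace ℝ (Fin d))).toSphere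

/-- The class `𝒜` (in dimension `d`) of functions `φ : [0, ∞) → [0, ∞)`, including the standing
regularity assumptions on `φ`. -/
structure ClassA (d : ℕ) (φ : ℝ≥0 → ℝ≥0) : Prop where
  /-- `φ` is continuous except at finitely many points ... -/
  finite_discontinuities : {t : ℝ≥0 | ¬ ContinuousAt φ t}.Finite
  /-- ... all of which lie in `(0, ∞)`. -/
  continuousAt_zero : ContinuousAt φ 0
  map_zero : φ 0 = 0
  /-- One-sided limits exist, and `φ t` is the smaller of the two. -/
  eq_min_limits : ∀ t : ℝ≥0, 0 < t → ∃ l r : ℝ≥0,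
    Tendsto φ (𝓝[<] t) (𝓝 l) ∧ Tendsto φ (𝓝[>] t) (𝓝 r) ∧ φ t = min r l
  le_sq : ∃ a : ℝ≥0, 0 < a ∧ ∀ t : ℝ≥0, t ≤ 1 → φ t ≤ a * t ^ 2
  bounded : ∃ b : ℝ≥0, 0 < b ∧ ∀ t : ℝ≥0, φ t ≤ b
  monotone : Monotone φ
  /-- `γ_d ∫_0^∞ φ(t) t⁻² dt = 1`. -/
  normalized : ∃ e : Metric.sphere (0 : EuclideanSpace ℝ (Fin d)) 1,
    gammaConst e * ∫⁻ t in Ioi (0 : ℝ), ENNReal.ofReal ((φ t.toNNReal : ℝ) / t ^ 2) = 1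

/-- `Λ(u) = ∫_Ω ∫_Ω φ(|u(x) - u(y)|) / |x - y|^{d+1} dx dy ∈ [0, ∞]`. -/
noncomputable def Lam {d : ℕ} (φ : ℝ≥0 → ℝ≥0) (Ω : Set (EuclideanSpace ℝ (Fin d)))
    (u : EuclideanSpace ℝ (Fin d) → ℝ) : ℝ≥0∞ :=
  ∫⁻ y in Ω, ∫⁻ x in Ω, ((φ ‖u x - u y‖₊ / ‖x - y‖₊ ^ (d + 1) : ℝ≥0) : ℝ≥0∞)

/-- `Λ_δ(u) = δ Λ(u / δ)`. -/
noncomputable def LamDelta {d : ℕ} (φ : ℝ≥0 → ℝ≥0) (Ω : Set (EuclideanSpace ℝ (Fin d)))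
    (δ : ℝ) (u : EuclideanSpace ℝ (Fin d) → ℝ) : ℝ≥0∞ :=
  ENNReal.ofReal δ * Lam φ Ω (fun x => u x / δ)

/-! Since `φ` is monotone and not identically zero, fix `t` with `φ t > 0` and put `l = t δ`. A
bound on Λ_δ(u) then bounds the jump energy l ∬ |x-y|^{-(d+1)} over the pairs with |u(x)-u(y)| ≥ l
(`mul_setLIntegral_jumpPairs_le_Lam`). The compactness argument uses only this, l → 0 and the L¹
bound.

The core is a nonlocal Poincaré inequality on convex sets, `setLIntegral_nearPairs_enorm_sub_le`.
Bisect the segment from x to y repeatedly: |f(x)-f(y)| is at most l times one plus the number of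
segments in the tree across which f jumps by at least l. At depth k there are 2^k segments, and the
change of variables to the endpoints of one of them costs 2^{kd}. So depth k contributes at most
2^{k(d+1)} times the measure of the jumping pairs at distance < D/2^k. Summing over k, a pair is
weighted by a geometric sum bounded by 2 (D/|x-y|)^{d+1}, which is the kernel of the jump energy.

On a bounded convex open set, divide the oscillation at scale 2h by the volume of order h^d of a
ball meeting the set. The error made in replacing u_n by averages over balls of radius h around a
finite net is then O(h) + O_h(l_n). The averages are bounded for fixed h, so the sequence is totally
bounded in L¹ (`totallyBoundedL1_of_convex`).

Near a boundary point a volume-preserving shear flattens Ω to a half-ball, which is convex, and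
finitely many such patches cover Ω. On the whole space, a weight decaying at infinity turns local
compactness and the global L¹ bound into compactness of a single weighted L¹ problem, so no diagonal
extraction is needed. -/

set_option linter.unusedSectionVars false

/-! ### Bisection and the nonlocal Poincaré inequality -/

section Bisection

variable {E : Type*} [NormedAddCommGroup E] [NormedSpace ℝ E]

/-- The number of nodes `(a, b)` of depth less than `K` in the tree of successive bisections of the
segment from `x` to `y` for which `|f a - f b| ≥ l`. -/
noncomputable def jumpCount (f : E → ℝ) (l : ℝ) : ℕ → E → E → ℕ
  | 0, _, _ => 0
  | K + 1, x, y => (if l ≤ |f x - f y| then 1 else 0) +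
      jumpCount f l K x ((2⁻¹ : ℝ) • (x + y)) + jumpCount f l K ((2⁻¹ : ℝ) • (x + y)) y

lemma jumpCount_le_succ (f : E → ℝ) (l : ℝ) (K : ℕ) (x y : E) :
    jumpCount f l K x y ≤ jumpCount f l (K + 1) x y := by
  induction K generalizing x y with
  | zero => simp [jumpCount]
  | succ K ih =>
    rw [jumpCount, jumpCount.eq_2 f l x y (K + 1)]
    gcongr
    · exact ih _ _
    · exact ih _ _

lemma jumpCount_mono (f : E → ℝ) (l : ℝ) (x y : E) : Monotone fun K => jumpCount f l K x y :=
  monotone_nat_of_le_succ fun K => jumpCount_le_succ f l K x y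

lemma Nat.exists_eq_bound_of_bounded {a : ℕ → ℕ} {n : ℕ} (ha : ∀ K, a K ≤ n) :
    ∃ K, ∀ K', a K' ≤ a K := by
  have hb : BddAbove (range a) := ⟨n, by rintro _ ⟨K, rfl⟩; exact ha K⟩
  obtain ⟨K, hK⟩ := Nat.sSup_mem (range_nonempty a) hb
  exact ⟨K, fun K' => hK ▸ le_csSup hb ⟨K', rfl⟩⟩

/-- If the root does not jump there is nothing to do. If it does, it uses up one unit of the count,
which pays for the extra `1` created by applying the bound to both halves. No regularity of `f` is
needed: bounded counts force the induction to stop. -/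
lemma abs_sub_le_of_jumpCount_le (f : E → ℝ) {l : ℝ} (hl : 0 ≤ l) (n : ℕ) (x y : E)
    (h : ∀ K, jumpCount f l K x y ≤ n) : |f x - f y| ≤ l * (1 + n) := by
  induction n using Nat.strong_induction_on generalizing x y with
  | _ n ih =>
  by_cases hxy : l ≤ |f x - f y|
  · set m := (2⁻¹ : ℝ) • (x + y) with hm
    have hs : ∀ K, 1 + jumpCount f l K x m + jumpCount f l K m y ≤ n := fun K => by
      have := h (K + 1)
      rwa [jumpCount, if_pos hxy] at this
    -- The two halves may reach their maximal counts at different depths; monotonicity in the depth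
    -- allows both to be compared at `max K₁ K₂`.
    obtain ⟨K₁, h₁⟩ := Nat.exists_eq_bound_of_bounded (a := fun K => jumpCount f l K x m) (n := n)
      fun K => by have := hs K; omega
    obtain ⟨K₂, h₂⟩ := Nat.exists_eq_bound_of_bounded (a := fun K => jumpCount f l K m y) (n := n)
      fun K => by have := hs K; omega
    have e := hs (max K₁ K₂)
    have e₁ := jumpCount_mono f l x m (le_max_left K₁ K₂)
    have e₂ := jumpCount_mono f l m y (le_max_right K₁ K₂)
    simp only at e₁ e₂ h₁ h₂
    have i₁ := ih _ (by omega) x m h₁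
    have i₂ := ih _ (by omega) m y h₂
    have hn : (1 : ℝ) + jumpCount f l K₁ x m + jumpCount f l K₂ m y ≤ n := by
      exact_mod_cast (by omega : 1 + jumpCount f l K₁ x m + jumpCount f l K₂ m y ≤ n)
    calc |f x - f y| ≤ |f x - f m| + |f m - f y| := abs_sub_le _ _ _
      _ ≤ l * (1 + (1 + jumpCount f l K₁ x m + jumpCount f l K₂ m y)) := by linarith
      _ ≤ l * (1 + n) := by gcongr
  · have : (0 : ℝ) ≤ n := n.cast_nonneg
    nlinarith

lemma enorm_sub_le_iSup_jumpCount (f : E → ℝ) {l : ℝ} (hl : 0 < l) (x y : E) :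
    ‖f x - f y‖ₑ ≤ ENNReal.ofReal l * (1 + ⨆ K, (jumpCount f l K x y : ℝ≥0∞)) := by
  by_cases h : ∃ n, ∀ K, jumpCount f l K x y ≤ n
  · obtain ⟨n, hn⟩ := h
    obtain ⟨K, hK⟩ := Nat.exists_eq_bound_of_bounded hn
    have := abs_sub_le_of_jumpCount_le f hl.le _ x y hK
    calc ‖f x - f y‖ₑ = ENNReal.ofReal |f x - f y| := Real.enorm_eq_ofReal_abs _
      _ ≤ ENNReal.ofReal (l * (1 + jumpCount f l K x y)) := ENNReal.ofReal_le_ofReal this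
      _ = ENNReal.ofReal l * (1 + (jumpCount f l K x y : ℝ≥0∞)) := by
        rw [ENNReal.ofReal_mul hl.le, ENNReal.ofReal_add zero_le_one (Nat.cast_nonneg _)]
        simp
      _ ≤ _ := by
        gcongr
        exact le_iSup (fun K => (jumpCount f l K x y : ℝ≥0∞)) K
  -- Unbounded counts make the right-hand side infinite.
  · push Not at h
    have : (⨆ K, (jumpCount f l K x y : ℝ≥0∞)) = ⊤ := by
      refine ENNReal.eq_top_of_forall_nnreal_le fun r => ?_
      obtain ⟨n, hn⟩ := exists_nat_gt r
      obtain ⟨K, hK⟩ := h n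
      refine le_trans ?_ (le_iSup (fun K => (jumpCount f l K x y : ℝ≥0∞)) K)
      have : r ≤ (jumpCount f l K x y : ℝ≥0) := hn.le.trans (by exact_mod_cast hK.le)
      exact_mod_cast this
    rw [this, add_top, ENNReal.mul_top (by simpa using hl)]
    exact le_top

variable [MeasurableSpace E] [BorelSpace E]

lemma measurable_jumpCount [SecondCountableTopology E] {f : E → ℝ} (hf : Measurable f) (l : ℝ)
    (K : ℕ) : Measurable fun z : E × E => jumpCount f l K z.1 z.2 := by
  induction K with
  | zero => simp [jumpCount]
  | succ K ih =>
    have hm : Measurable fun z : E × E => (2⁻¹ : ℝ) • (z.1 + z.2) := by fun_prop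
    simp only [jumpCount]
    refine (Measurable.add ?_ ?_).add ?_
    · refine Measurable.ite ?_ measurable_const measurable_const
      exact measurableSet_le measurable_const (by fun_prop)
    · exact ih.comp (measurable_fst.prodMk hm)
    · exact ih.comp (hm.prodMk measurable_snd)

/-- Pairs of points of `V` at distance less than `D`. -/
def nearPairs (V : Set E) (D : ℝ) : Set (E × E) := {z | z.1 ∈ V ∧ z.2 ∈ V ∧ dist z.1 z.2 < D}

/-- Pairs of points between which `f` varies by at least `l`. -/
def jumpPairs (f : E → ℝ) (l : ℝ) : Set (E × E) := {z | l ≤ |f z.1 - f z.2|}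

/-- The kernel `|x - y|^{-(d+1)}`, with value `0` on the diagonal. -/
noncomputable def singKernel (z : E × E) : ℝ≥0∞ :=
  (((‖z.1 - z.2‖₊ ^ (Module.finrank ℝ E + 1))⁻¹ : ℝ≥0) : ℝ≥0∞)

lemma measurable_singKernel [SecondCountableTopology E] :
    Measurable (singKernel : E × E → ℝ≥0∞) := by
  unfold singKernel
  fun_prop

lemma measurableSet_nearPairs [SecondCountableTopology E] {V : Set E} (hV : MeasurableSet V)
    (D : ℝ) : MeasurableSet (nearPairs V D) :=
  (measurable_fst hV).inter ((measurable_snd hV).inter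
    (measurableSet_lt measurable_dist measurable_const))

lemma measurableSet_jumpPairs {f : E → ℝ} (hf : Measurable f) (l : ℝ) :
    MeasurableSet (jumpPairs f l) :=
  measurableSet_le measurable_const (by fun_prop)

lemma nearPairs_mono (V : Set E) {D D' : ℝ} (h : D ≤ D') : nearPairs V D ⊆ nearPairs V D' :=
  fun _ hz => ⟨hz.1, hz.2.1, hz.2.2.trans_le h⟩

lemma Convex.mid_mem {V : Set E} (hV : Convex ℝ V) {x y : E} (hx : x ∈ V) (hy : y ∈ V) :
    (2⁻¹ : ℝ) • (x + y) ∈ V := by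
  rw [smul_add]
  exact hV hx hy (by norm_num) (by norm_num) (by norm_num)

lemma dist_mid_left (x y : E) : dist x ((2⁻¹ : ℝ) • (x + y)) = dist x y / 2 := by
  have : x - (2⁻¹ : ℝ) • (x + y) = (2⁻¹ : ℝ) • (x - y) := by module
  rw [dist_eq_norm, this, norm_smul, dist_eq_norm]
  norm_num
  ring

lemma dist_mid_right (x y : E) : dist ((2⁻¹ : ℝ) • (x + y)) y = dist x y / 2 := by
  rw [dist_comm, add_comm, dist_mid_left, dist_comm]

variable [FiniteDimensional ℝ E] (μ : Measure E) [μ.IsAddHaarMeasure]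

/-- For fixed `x` the midpoint map is a translation followed by the homothety of ratio 1/2, whence
the Jacobian factor. -/
lemma lintegral_comp_mid {F : E → ℝ≥0∞} (hF : Measurable F) (x : E) :
    ∫⁻ y, F ((2⁻¹ : ℝ) • (x + y)) ∂μ = 2 ^ Module.finrank ℝ E * ∫⁻ y, F y ∂μ := by
  rw [lintegral_add_left_eq_self (fun y => F ((2⁻¹ : ℝ) • y)) x,
    ← lintegral_map (μ := μ) hF (measurable_const_smul (2⁻¹ : ℝ)),
    Measure.map_addHaar_smul μ (by norm_num), lintegral_smul_measure, smul_eq_mul]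
  congr 1
  rw [inv_pow, inv_inv, abs_of_pos (by positivity), ENNReal.ofReal_pow (by norm_num)]
  simp

lemma lintegral_prod_comp_mid_right {G : E × E → ℝ≥0∞} (hG : Measurable G) :
    ∫⁻ z, G (z.1, (2⁻¹ : ℝ) • (z.1 + z.2)) ∂(μ.prod μ) =
      2 ^ Module.finrank ℝ E * ∫⁻ z, G z ∂(μ.prod μ) := by
  rw [lintegral_prod _ (by fun_prop), lintegral_prod _ hG.aemeasurable,
    ← lintegral_const_mul _ hG.lintegral_prod_right']
  refine lintegral_congr fun x => ?_
  exact lintegral_comp_mid μ (F := fun y => G (x, y)) (by fun_prop) x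

lemma lintegral_prod_comp_mid_left {G : E × E → ℝ≥0∞} (hG : Measurable G) :
    ∫⁻ z, G ((2⁻¹ : ℝ) • (z.1 + z.2), z.2) ∂(μ.prod μ) =
      2 ^ Module.finrank ℝ E * ∫⁻ z, G z ∂(μ.prod μ) := by
  have h := lintegral_prod_comp_mid_right μ (G := fun z => G z.swap) (hG.comp measurable_swap)
  rw [lintegral_prod_swap] at h
  rw [← h, ← lintegral_prod_swap]
  simp [add_comm]

/-- This is where convexity enters: the midpoint stays in `V`, and the new pair is at half the
distance. -/
lemma setLIntegral_nearPairs_comp_mid_right {V : Set E} (hVm : MeasurableSet V) (hV : Convex ℝ V)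
    {F : E × E → ℝ≥0∞} (hF : Measurable F) (D : ℝ) :
    ∫⁻ z in nearPairs V D, F (z.1, (2⁻¹ : ℝ) • (z.1 + z.2)) ∂(μ.prod μ) ≤
      2 ^ Module.finrank ℝ E * ∫⁻ z in nearPairs V (D / 2), F z ∂(μ.prod μ) := by
  rw [← lintegral_indicator (measurableSet_nearPairs hVm _),
    ← lintegral_indicator (measurableSet_nearPairs hVm _),
    ← lintegral_prod_comp_mid_right μ (hF.indicator (measurableSet_nearPairs hVm _))]
  refine lintegral_mono fun z => ?_
  by_cases hz : z ∈ nearPairs V D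
  swap
  · simp [hz]
  rw [indicator_of_mem hz, indicator_of_mem]
  exact ⟨hz.1, hV.mid_mem hz.1 hz.2.1, by simp only [dist_mid_left]; linarith [hz.2.2]⟩

lemma setLIntegral_nearPairs_comp_mid_left {V : Set E} (hVm : MeasurableSet V) (hV : Convex ℝ V)
    {F : E × E → ℝ≥0∞} (hF : Measurable F) (D : ℝ) :
    ∫⁻ z in nearPairs V D, F ((2⁻¹ : ℝ) • (z.1 + z.2), z.2) ∂(μ.prod μ) ≤
      2 ^ Module.finrank ℝ E * ∫⁻ z in nearPairs V (D / 2), F z ∂(μ.prod μ) := by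
  rw [← lintegral_indicator (measurableSet_nearPairs hVm _),
    ← lintegral_indicator (measurableSet_nearPairs hVm _),
    ← lintegral_prod_comp_mid_left μ (hF.indicator (measurableSet_nearPairs hVm _))]
  refine lintegral_mono fun z => ?_
  by_cases hz : z ∈ nearPairs V D
  swap
  · simp [hz]
  rw [indicator_of_mem hz, indicator_of_mem]
  exact ⟨hV.mid_mem hz.1 hz.2.1, hz.2.1, by simp only [dist_mid_right]; linarith [hz.2.2]⟩

lemma one_le_mul_singKernel {z : E × E} {D : ℝ} (hz : z.1 ≠ z.2) (hD : dist z.1 z.2 ≤ D) :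
    1 ≤ ENNReal.ofReal D ^ (Module.finrank ℝ E + 1) * singKernel z := by
  have h0 : ‖z.1 - z.2‖₊ ≠ 0 := by simpa [sub_eq_zero] using hz
  have h1 : (‖z.1 - z.2‖₊ : ℝ≥0∞) ≤ ENNReal.ofReal D := by
    rw [dist_eq_norm] at hD
    rw [← enorm_eq_nnnorm, ← ofReal_norm]
    exact ENNReal.ofReal_le_ofReal hD
  unfold singKernel
  rw [ENNReal.coe_inv (pow_ne_zero _ h0), ENNReal.coe_pow]
  calc (1 : ℝ≥0∞) = (‖z.1 - z.2‖₊ : ℝ≥0∞) ^ (Module.finrank ℝ E + 1) *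
        ((‖z.1 - z.2‖₊ : ℝ≥0∞) ^ (Module.finrank ℝ E + 1))⁻¹ :=
      (ENNReal.mul_inv_cancel (pow_ne_zero _ (by simpa using h0)) (by finiteness)).symm
    _ ≤ _ := by gcongr

/-- On `S` the kernel is at least D^{-(d+1)}. Positivity of `l` keeps jump pairs off the diagonal,
where the kernel is 0 by convention. -/
lemma measure_jumpPairs_le {f : E → ℝ} {l : ℝ} (hl : 0 < l) {D : ℝ} {S : Set (E × E)}
    (hSm : MeasurableSet S) (hS : S ⊆ jumpPairs f l) (hD : ∀ z ∈ S, dist z.1 z.2 ≤ D) :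
    (μ.prod μ) S ≤ ENNReal.ofReal D ^ (Module.finrank ℝ E + 1) *
      ∫⁻ z in S, singKernel z ∂(μ.prod μ) := by
  rw [← lintegral_const_mul _ measurable_singKernel, ← setLIntegral_one]
  refine setLIntegral_mono' hSm fun z hz => one_le_mul_singKernel ?_ (hD z hz)
  intro h
  have := hS hz
  simp [jumpPairs, h] at this
  linarith

/-- One level of the tree: each of the two halves costs 2^d by change of variables, which gives the
factor 2^{d+1}. -/
lemma setLIntegral_jumpCount_succ_le {V : Set E} (hVm : MeasurableSet V) (hV : Convex ℝ V)
    {f : E → ℝ} (hf : Measurable f) (l : ℝ) (K : ℕ) (D : ℝ) :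
    ∫⁻ z in nearPairs V D, (jumpCount f l (K + 1) z.1 z.2 : ℝ≥0∞) ∂(μ.prod μ) ≤
      (μ.prod μ) (nearPairs V D ∩ jumpPairs f l) + 2 ^ (Module.finrank ℝ E + 1) *
        ∫⁻ z in nearPairs V (D / 2), (jumpCount f l K z.1 z.2 : ℝ≥0∞) ∂(μ.prod μ) := by
  have hT : Measurable fun z : E × E => (jumpCount f l K z.1 z.2 : ℝ≥0∞) :=
    measurable_from_top.comp (measurable_jumpCount hf l K)
  have hm : Measurable fun z : E × E => (2⁻¹ : ℝ) • (z.1 + z.2) := by fun_prop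
  have h1 := setLIntegral_nearPairs_comp_mid_right μ hVm hV hT D
  have h2 := setLIntegral_nearPairs_comp_mid_left μ hVm hV hT D
  have hJ := measurableSet_jumpPairs hf l
  have m1 : Measurable fun z : E × E =>
      (jumpCount f l K z.1 ((2⁻¹ : ℝ) • (z.1 + z.2)) : ℝ≥0∞) := hT.comp (measurable_fst.prodMk hm)
  have m2 : Measurable fun z : E × E =>
      (jumpCount f l K ((2⁻¹ : ℝ) • (z.1 + z.2)) z.2 : ℝ≥0∞) := hT.comp (hm.prodMk measurable_snd)
  have e : ∀ z : E × E, (jumpCount f l (K + 1) z.1 z.2 : ℝ≥0∞) =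
      (jumpPairs f l).indicator 1 z + (jumpCount f l K z.1 ((2⁻¹ : ℝ) • (z.1 + z.2)) : ℝ≥0∞) +
        (jumpCount f l K ((2⁻¹ : ℝ) • (z.1 + z.2)) z.2 : ℝ≥0∞) := fun z => by
    simp only [jumpCount, Nat.cast_add]
    congr 2
    by_cases h : l ≤ |f z.1 - f z.2|
    · rw [if_pos h, indicator_of_mem (show z ∈ jumpPairs f l from h)]
      simp
    · rw [if_neg h, indicator_of_notMem (show z ∉ jumpPairs f l from h)]
      simp
  simp only [e]
  rw [lintegral_add_right _ m2, lintegral_add_right _ m1, lintegral_indicator_one hJ,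
    Measure.restrict_apply hJ, inter_comm, pow_succ, mul_two, add_mul, add_assoc]
  gcongr

/-- Sum over all scales of the bisection tree. -/
lemma setLIntegral_jumpCount_le {V : Set E} (hVm : MeasurableSet V) (hV : Convex ℝ V)
    {f : E → ℝ} (hf : Measurable f) {l : ℝ} (hl : 0 < l) (K : ℕ) {D : ℝ} (hD : 0 < D) :
    ∫⁻ z in nearPairs V D, (jumpCount f l K z.1 z.2 : ℝ≥0∞) ∂(μ.prod μ) +
        (μ.prod μ) (nearPairs V D ∩ jumpPairs f l) ≤
      2 * ENNReal.ofReal D ^ (Module.finrank ℝ E + 1) *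
        ∫⁻ z in nearPairs V D ∩ jumpPairs f l, singKernel z ∂(μ.prod μ) := by
  -- The measure term on the left strengthens the induction hypothesis: it absorbs the root's
  -- contribution for pairs at distance less than D/2.
  induction K generalizing D with
  | zero =>
    simp only [jumpCount, Nat.cast_zero, lintegral_zero, zero_add]
    refine (measure_jumpPairs_le μ hl ((measurableSet_nearPairs hVm D).inter
      (measurableSet_jumpPairs hf l)) inter_subset_right fun z hz => hz.1.2.2.le).trans ?_
    gcongr
    exact le_mul_of_one_le_left (zero_le) one_le_two
  | succ K ih =>
    set p := Module.finrank ℝ E + 1 with hp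
    -- Pairs in `A` are handled by the induction hypothesis at scale D/2. Those in `B` lie at
    -- distance at least D/2 and are paid for directly by the kernel at scale D.
    set A := nearPairs V (D / 2) ∩ jumpPairs f l with hA
    set B := (nearPairs V D ∩ jumpPairs f l) \ A with hB
    have hAm : MeasurableSet A :=
      (measurableSet_nearPairs hVm _).inter (measurableSet_jumpPairs hf l)
    have hBm : MeasurableSet B :=
      ((measurableSet_nearPairs hVm _).inter (measurableSet_jumpPairs hf l)).diff hAm
    have hAB : nearPairs V D ∩ jumpPairs f l = A ∪ B := by
      rw [hB, union_sdiff_cancel]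
      exact inter_subset_inter_left _ (nearPairs_mono V (by linarith))
    have hd : Disjoint A B := disjoint_sdiff_right
    have hi := ih (half_pos hD)
    have hs := setLIntegral_jumpCount_succ_le μ hVm hV hf l K D
    have hb := measure_jumpPairs_le μ hl (D := D) hBm (fun z hz => hz.1.2)
      fun z hz => hz.1.1.2.2.le
    rw [← hA] at hi
    rw [hAB] at hs ⊢
    rw [measure_union hd hBm] at hs ⊢
    rw [lintegral_union hBm hd]
    rw [← hp] at hb
    set J := ∫⁻ z in nearPairs V (D / 2), (jumpCount f l K z.1 z.2 : ℝ≥0∞) ∂(μ.prod μ)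
    have h2 : (2 : ℝ≥0∞) ≤ 2 ^ p := by
      calc (2 : ℝ≥0∞) = 2 ^ 1 := (pow_one _).symm
        _ ≤ 2 ^ p := pow_le_pow_right₀ one_le_two (by omega)
    have hD2 : ENNReal.ofReal D = 2 * ENNReal.ofReal (D / 2) := by
      rw [← ENNReal.ofReal_ofNat 2, ← ENNReal.ofReal_mul (by norm_num)]
      congr 1
      ring
    calc _ ≤ ((μ.prod μ) A + (μ.prod μ) B + 2 ^ p * J) + ((μ.prod μ) A + (μ.prod μ) B) := by gcongr
      _ = 2 * (μ.prod μ) A + 2 ^ p * J + 2 * (μ.prod μ) B := by ring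
      _ ≤ 2 ^ p * (μ.prod μ) A + 2 ^ p * J + 2 * (ENNReal.ofReal D ^ p *
          ∫⁻ z in B, singKernel z ∂(μ.prod μ)) := by gcongr
      _ = 2 ^ p * (J + (μ.prod μ) A) + 2 * (ENNReal.ofReal D ^ p *
          ∫⁻ z in B, singKernel z ∂(μ.prod μ)) := by ring
      _ ≤ 2 ^ p * (2 * ENNReal.ofReal (D / 2) ^ p * ∫⁻ z in A, singKernel z ∂(μ.prod μ)) +
          2 * (ENNReal.ofReal D ^ p * ∫⁻ z in B, singKernel z ∂(μ.prod μ)) := by gcongr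
      -- The factor 2^p of one bisection is exactly the ratio of D^p to (D/2)^p, so nothing is lost
      -- from one scale to the next.
      _ = _ := by rw [hD2, mul_pow]; ring

/-- Nonlocal Poincaré inequality on a convex set: the mean oscillation at scale `D` is controlled
by the pairs across which `f` varies by at least `l`. -/
theorem setLIntegral_nearPairs_enorm_sub_le {V : Set E} (hVm : MeasurableSet V) (hV : Convex ℝ V)
    {f : E → ℝ} (hf : Measurable f) {l : ℝ} (hl : 0 < l) {D : ℝ} (hD : 0 < D) :
    ∫⁻ z in nearPairs V D, ‖f z.1 - f z.2‖ₑ ∂(μ.prod μ) ≤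
      ENNReal.ofReal l * ((μ.prod μ) (nearPairs V D) +
        2 * ENNReal.ofReal D ^ (Module.finrank ℝ E + 1) *
          ∫⁻ z in (V ×ˢ V) ∩ jumpPairs f l, singKernel z ∂(μ.prod μ)) := by
  have hT : ∀ K, Measurable fun z : E × E => (jumpCount f l K z.1 z.2 : ℝ≥0∞) := fun K =>
    measurable_from_top.comp (measurable_jumpCount hf l K)
  calc ∫⁻ z in nearPairs V D, ‖f z.1 - f z.2‖ₑ ∂(μ.prod μ)
      ≤ ∫⁻ z in nearPairs V D, ENNReal.ofReal l *
          (1 + ⨆ K, (jumpCount f l K z.1 z.2 : ℝ≥0∞)) ∂(μ.prod μ) :=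
        lintegral_mono fun z => enorm_sub_le_iSup_jumpCount f hl _ _
    _ = ENNReal.ofReal l * ((μ.prod μ) (nearPairs V D) +
          ⨆ K, ∫⁻ z in nearPairs V D, (jumpCount f l K z.1 z.2 : ℝ≥0∞) ∂(μ.prod μ)) := by
        rw [lintegral_const_mul' _ _ ENNReal.ofReal_ne_top, lintegral_add_left measurable_const,
          setLIntegral_one, lintegral_iSup hT]
        exact fun K K' h z => Nat.cast_le.2 (jumpCount_mono f l z.1 z.2 h)
    _ ≤ _ := by
        gcongr
        refine iSup_le fun K => le_self_add.trans
          ((setLIntegral_jumpCount_le μ hVm hV hf hl K hD).trans ?_)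
        gcongr
        exact fun z hz => ⟨hz.1, hz.2.1⟩

end Bisection

/-! ### Total boundedness and subsequences in L¹ -/

section TotallyBoundedL1

variable {α : Type*} [MeasurableSpace α]

/-- The sequence `u` is totally bounded for the distance `∫ |f - g| dν`. -/
def TotallyBoundedL1 (ν : Measure α) (u : ℕ → α → ℝ) : Prop :=
  ∀ ε : ℝ≥0, 0 < ε → ∃ F : Set (α → ℝ), F.Finite ∧ (∀ g ∈ F, Integrable g ν) ∧
    ∀ n, ∃ g ∈ F, ∫⁻ x, ‖u n x - g x‖ₑ ∂ν ≤ ε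

lemma TotallyBoundedL1.mono {ν : Measure α} {S T : Set α} {u : ℕ → α → ℝ}
    (h : TotallyBoundedL1 (ν.restrict T) u) (hST : S ⊆ T) :
    TotallyBoundedL1 (ν.restrict S) u := fun ε hε => by
  obtain ⟨F, hF, hi, hu⟩ := h ε hε
  have hle := Measure.restrict_mono hST (le_refl ν)
  refine ⟨F, hF, fun g hg => (hi g hg).mono_measure hle, fun n => ?_⟩
  obtain ⟨g, hg, hn⟩ := hu n
  exact ⟨g, hg, (lintegral_mono' hle le_rfl).trans hn⟩

lemma totallyBoundedL1_empty (ν : Measure α) (u : ℕ → α → ℝ) :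
    TotallyBoundedL1 (ν.restrict ∅) u :=
  fun ε _ => ⟨{0}, finite_singleton _, by simp, fun n => ⟨0, rfl, by simp⟩⟩

lemma TotallyBoundedL1.union {ν : Measure α} {S T : Set α} {u : ℕ → α → ℝ}
    (hSm : MeasurableSet S) (hTm : MeasurableSet T)
    (hS : TotallyBoundedL1 (ν.restrict S) u) (hT : TotallyBoundedL1 (ν.restrict T) u) :
    TotallyBoundedL1 (ν.restrict (S ∪ T)) u := by
  classical
  intro ε hε
  obtain ⟨F, hF, hFi, hFu⟩ := hS (ε / 2) (by positivity)
  obtain ⟨G, hG, hGi, hGu⟩ := (hT.mono (sdiff_subset (t := S))) (ε / 2) (by positivity)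
  have hd : Disjoint S (T \ S) := disjoint_sdiff_right
  have hm : MeasurableSet (T \ S) := hTm.diff hSm
  rw [← union_sdiff_self]
  have e₁ : ∀ (f g : α → ℝ), EqOn (S.piecewise f g) f S := fun f g => piecewise_eqOn _ _ _
  have e₂ : ∀ (f g : α → ℝ), EqOn (S.piecewise f g) g (T \ S) := fun f g x hx =>
    piecewise_eq_of_notMem _ _ _ hx.2
  refine ⟨image2 (fun f g => S.piecewise f g) F G, hF.image2 _ hG, ?_, fun n => ?_⟩
  · rintro _ ⟨f, hf, g, hg, rfl⟩
    refine IntegrableOn.union ?_ ?_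
    · exact IntegrableOn.congr_fun (hFi f hf) (e₁ f g).symm hSm
    · exact IntegrableOn.congr_fun (hGi g hg) (e₂ f g).symm hm
  · obtain ⟨f, hf, hfu⟩ := hFu n
    obtain ⟨g, hg, hgu⟩ := hGu n
    refine ⟨_, mem_image2_of_mem hf hg, ?_⟩
    rw [lintegral_union hm hd,
      setLIntegral_congr_fun (g := fun x => ‖u n x - f x‖ₑ) hSm (fun x hx => by simp only [e₁ f g hx]),
      setLIntegral_congr_fun (g := fun x => ‖u n x - g x‖ₑ) hm (fun x hx => by simp only [e₂ f g hx])]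
    calc _ ≤ ((ε / 2 : ℝ≥0) : ℝ≥0∞) + ((ε / 2 : ℝ≥0) : ℝ≥0∞) := add_le_add hfu hgu
      _ = ε := by rw [← ENNReal.coe_add, add_halves]

lemma totallyBoundedL1_biUnion {ν : Measure α} {ι : Type*} (s : Finset ι) {S : ι → Set α}
    {u : ℕ → α → ℝ} (hSm : ∀ i ∈ s, MeasurableSet (S i))
    (hS : ∀ i ∈ s, TotallyBoundedL1 (ν.restrict (S i)) u) :
    TotallyBoundedL1 (ν.restrict (⋃ i ∈ s, S i)) u := by
  classical
  induction s using Finset.induction_on with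
  | empty => simpa using totallyBoundedL1_empty ν u
  | insert a s _ ih =>
    rw [Finset.set_biUnion_insert]
    exact (hS a (by simp)).union (hSm a (by simp))
      (Finset.measurableSet_biUnion _ fun i hi => hSm i (by simp [hi]))
      (ih (fun i hi => hSm i (by simp [hi])) fun i hi => hS i (by simp [hi]))

lemma TotallyBoundedL1.of_comp {ν : Measure α} {Φ : α ≃ᵐ α} (hΦ : MeasurePreserving Φ ν ν)
    {V : Set α} {u : ℕ → α → ℝ}
    (h : TotallyBoundedL1 (ν.restrict V) fun n x => u n (Φ x)) :
    TotallyBoundedL1 (ν.restrict (Φ '' V)) u := by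
  have hr : MeasurePreserving Φ (ν.restrict V) (ν.restrict (Φ '' V)) :=
    hΦ.restrict_image_emb Φ.measurableEmbedding V
  intro ε hε
  obtain ⟨F, hF, hi, hu⟩ := h ε hε
  refine ⟨(fun g => g ∘ Φ.symm) '' F, hF.image _, ?_, fun n => ?_⟩
  · rintro _ ⟨g, hg, rfl⟩
    rw [← hr.integrable_comp_emb Φ.measurableEmbedding]
    convert hi g hg using 1
    ext x
    simp
  · obtain ⟨g, hg, hn⟩ := hu n
    refine ⟨_, mem_image_of_mem _ hg, ?_⟩
    rw [← hr.lintegral_comp_emb Φ.measurableEmbedding]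
    simpa using hn

/-- A sequence of integrable functions which is eventually approximated by step functions over a
fixed finite partition with bounded values is totally bounded. -/
lemma totallyBoundedL1_of_step {ν : Measure α} [IsFiniteMeasure ν] {u : ℕ → α → ℝ}
    (hu : ∀ n, Integrable (u n) ν)
    (h : ∀ ε : ℝ≥0, 0 < ε → ∃ (π : SimpleFunc α ℕ) (B : ℝ) (N : ℕ) (c : ℕ → ℕ → ℝ),
      (∀ n i, |c n i| ≤ B) ∧ ∀ n ≥ N, ∫⁻ x, ‖u n x - c n (π x)‖ₑ ∂ν ≤ ε) :
    TotallyBoundedL1 ν u := by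
  classical
  intro ε hε
  obtain ⟨π, B, N, c, hB, hc⟩ := h (ε / 2) (by positivity)
  -- Mesh of the grid to which the step values are rounded down, so that rounding costs at most ε/2
  -- in total. The `+ 1` covers zero mass.
  set η : ℝ≥0 := ε / (2 * ((ν univ).toNNReal + 1)) with hη
  have hη0 : 0 < η := by positivity
  have hη1 : (η : ℝ≥0∞) * ν univ ≤ ((ε / 2 : ℝ≥0) : ℝ≥0∞) := by
    rw [← ENNReal.coe_toNNReal (measure_ne_top ν univ), ← ENNReal.coe_mul, ENNReal.coe_le_coe, hη]
    rw [div_mul_eq_mul_div, div_le_div_iff₀ (by positivity) (by positivity)]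
    nlinarith [zero_le (a := ε)]
  set M : ℤ := ⌈B / η⌉ + 1
  let P : (π.range → Icc (-M) M) → SimpleFunc α ℝ := fun k =>
    π.map fun i => if hi : i ∈ π.range then (η : ℝ) * (k ⟨i, hi⟩ : ℤ) else 0
  -- The finitely many terms before `N` serve as their own approximants.
  refine ⟨range (fun k => ⇑(P k)) ∪ u '' Iio N, (finite_range _).union ((finite_Iio N).image u),
    ?_, fun n => ?_⟩
  · rintro g (⟨k, rfl⟩ | ⟨n, -, rfl⟩)
    · exact SimpleFunc.integrable_of_isFiniteMeasure _
    · exact hu n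
  · rcases lt_or_ge n N with hn | hn
    · exact ⟨u n, Or.inr ⟨n, hn, rfl⟩, by simp⟩
    have hk : ∀ i, ⌊c n i / η⌋ ∈ Icc (-M) M := fun i => by
      have h1 := abs_le.1 (hB n i)
      have h2 : c n i / η ≤ B / η := by gcongr; exact h1.2
      have h3 : -(B / η) ≤ c n i / η := by
        rw [← neg_div]
        gcongr
        exact h1.1
      have h4 := Int.le_ceil (B / (η : ℝ))
      constructor
      · rw [Int.le_floor]
        push_cast [M]
        linarith
      · have := (Int.floor_le (c n i / η)).trans (h2.trans h4)
        have : ⌊c n i / η⌋ ≤ ⌈B / (η : ℝ)⌉ := by exact_mod_cast this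
        omega
    let k : π.range → Icc (-M) M := fun i => ⟨⌊c n i.1 / η⌋, hk i.1⟩
    refine ⟨P k, Or.inl ⟨k, rfl⟩, ?_⟩
    have hp : ∀ x, P k x = η * ⌊c n (π x) / η⌋ := fun x => by
      simp [P, k]
    have hx : ∀ x, ‖u n x - P k x‖ₑ ≤
        η + ‖u n x - c n (π x)‖ₑ := fun x => by
      rw [hp]
      have hq : ‖c n (π x) - η * ⌊c n (π x) / η⌋‖ₑ ≤ η := by
        rw [Real.enorm_eq_ofReal_abs, ← ENNReal.ofReal_coe_nnreal]
        refine ENNReal.ofReal_le_ofReal ?_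
        have hη0' : (0 : ℝ) < η := hη0
        have f1 := Int.floor_le (c n (π x) / η)
        have f2 := (Int.lt_floor_add_one (c n (π x) / η)).le
        rw [le_div_iff₀ hη0'] at f1
        rw [div_le_iff₀ hη0'] at f2
        rw [abs_le]
        constructor <;> nlinarith
      calc _ = ‖(c n (π x) - η * ⌊c n (π x) / η⌋) + (u n x - c n (π x))‖ₑ := by
            congr 1
            ring
        _ ≤ _ := (enorm_add_le _ _).trans (by gcongr)
    calc _ ≤ ∫⁻ x, (η + ‖u n x - c n (π x)‖ₑ) ∂ν := lintegral_mono hx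
      _ = η * ν univ + ∫⁻ x, ‖u n x - c n (π x)‖ₑ ∂ν := by
        rw [lintegral_add_left measurable_const, lintegral_const]
      _ ≤ ((ε / 2 : ℝ≥0) : ℝ≥0∞) + ((ε / 2 : ℝ≥0) : ℝ≥0∞) := add_le_add hη1 (hc n hn)
      _ = ε := by rw [← ENNReal.coe_add, add_halves]

/-- A totally bounded sequence of integrable functions has a subsequence converging in `L¹`. -/
lemma TotallyBoundedL1.exists_subseq {ν : Measure α} {u : ℕ → α → ℝ} (h : TotallyBoundedL1 ν u)
    (hu : ∀ n, Integrable (u n) ν) :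
    ∃ (k : ℕ → ℕ) (v : α → ℝ), StrictMono k ∧ Integrable v ν ∧
      Tendsto (fun j => ∫⁻ x, ‖u (k j) x - v x‖ₑ ∂ν) atTop (𝓝 0) := by
  let U : ℕ → Lp ℝ 1 ν := fun n => (hu n).toL1 (u n)
  have hd : ∀ n (g : α → ℝ) (hg : Integrable g ν),
      edist (U n) (hg.toL1 g) = ∫⁻ x, ‖u n x - g x‖ₑ ∂ν := fun n g hg => by
    rw [Integrable.edist_toL1_toL1]
    simp only [edist_eq_enorm_sub]
  have htb : TotallyBounded (range U) := by
    rw [EMetric.totallyBounded_iff]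
    intro ε hε
    obtain ⟨r, hr0, hr⟩ := ENNReal.lt_iff_exists_nnreal_btwn.1 hε
    obtain ⟨F, hF, hi, hFu⟩ := h r (by exact_mod_cast hr0)
    have : Finite F := hF
    refine ⟨range fun g : F => (hi g g.2).toL1 (g : α → ℝ), finite_range _, ?_⟩
    rintro _ ⟨n, rfl⟩
    obtain ⟨g, hg, hn⟩ := hFu n
    refine mem_iUnion₂.2 ⟨_, ⟨⟨g, hg⟩, rfl⟩, ?_⟩
    rw [Metric.mem_eball, hd]
    exact hn.trans_lt hr
  obtain ⟨w, -, k, hk, hlim⟩ := (htb.closure.isCompact_of_isClosed isClosed_closure).tendsto_subseq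
    fun n => subset_closure (mem_range_self (f := U) n)
  have hw : Integrable (w : α → ℝ) ν := L1.integrable_coeFn w
  refine ⟨k, w, hk, hw, ?_⟩
  rw [tendsto_iff_edist_tendsto_0] at hlim
  refine hlim.congr fun j => ?_
  rw [← hd _ _ hw, Integrable.toL1_coeFn, Function.comp]

end TotallyBoundedL1

/-! ### Compactness on bounded convex open sets -/

section Convex

variable {E : Type*} [NormedAddCommGroup E] [NormedSpace ℝ E] [MeasurableSpace E] [BorelSpace E]
  [FiniteDimensional ℝ E] (μ : Measure E) [μ.IsAddHaarMeasure]

lemma enorm_sub_setAverage_le {S : Set E} {f : E → ℝ} (h0 : μ S ≠ 0) (ht : μ S ≠ ⊤)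
    (hf : IntegrableOn f S μ) (a : ℝ) :
    ‖a - ⨍ y in S, f y ∂μ‖ₑ ≤ (μ S)⁻¹ * ∫⁻ y in S, ‖a - f y‖ₑ ∂μ := by
  have hp : IsProbabilityMeasure ((μ.restrict S univ)⁻¹ • μ.restrict S) :=
    ⟨by simp [ENNReal.inv_mul_cancel h0 ht]⟩
  have hi : Integrable f ((μ.restrict S univ)⁻¹ • μ.restrict S) :=
    hf.smul_measure (by simp [h0])
  have : a - ⨍ y in S, f y ∂μ = ∫ y, (a - f y) ∂((μ.restrict S univ)⁻¹ • μ.restrict S) := by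
    rw [integral_sub (integrable_const a) hi, integral_const, probReal_univ, one_smul, average]
  rw [this]
  refine (enorm_integral_le_lintegral_enorm _).trans ?_
  rw [lintegral_smul_measure, Measure.restrict_apply_univ, smul_eq_mul]

/-- A bounded convex open set has uniformly positive density at its points at small scales. -/
lemma Convex.exists_measure_inter_ball_ge {V : Set E} (hVo : IsOpen V) (hV : Convex ℝ V)
    (hb : Bornology.IsBounded V) (hne : V.Nonempty) :
    ∃ c : ℝ, 0 < c ∧ ∃ h₀ : ℝ, 0 < h₀ ∧ ∀ p ∈ V, ∀ h : ℝ, 0 < h → h ≤ h₀ →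
      ENNReal.ofReal (c * h ^ Module.finrank ℝ E) ≤ μ (V ∩ Metric.ball p h) := by
  obtain ⟨x₀, hx₀⟩ := hne
  obtain ⟨ρ, hρ, hball⟩ := Metric.isOpen_iff.1 hVo x₀ hx₀
  obtain ⟨R, hR⟩ := hb.subset_ball x₀
  have hR0 : 0 < R := by simpa using hR hx₀
  set M := R + ρ with hM
  have hM0 : 0 < M := by positivity
  set m := (μ (Metric.ball (0 : E) 1)).toReal with hm
  have hm0 : 0 < m := ENNReal.toReal_pos (Metric.measure_ball_pos μ 0 one_pos).ne'
    measure_ball_lt_top.ne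
  refine ⟨(ρ / M) ^ Module.finrank ℝ E * m, by positivity, M, hM0, fun p hp h hh hhM => ?_⟩
  set t := h / M with ht
  have ht0 : 0 < t := by positivity
  have ht1 : t ≤ 1 := (div_le_one hM0).2 hhM
  -- The homothety of centre `p` and ratio `t ≤ 1` sends the ball of radius `ρ` inside `V` to this
  -- ball. Convexity keeps it in `V`, and `t (R + ρ) = h` keeps it within `h` of `p`.
  have hsub : Metric.ball (p + t • (x₀ - p)) (t * ρ) ⊆ V ∩ Metric.ball p h := by
    intro z hz
    rw [Metric.mem_ball, dist_eq_norm] at hz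
    set q := x₀ + t⁻¹ • (z - (p + t • (x₀ - p))) with hq
    have hqV : q ∈ V := hball (by
      rw [Metric.mem_ball, dist_eq_norm, hq, add_sub_cancel_left, norm_smul, norm_inv,
        Real.norm_of_nonneg ht0.le, inv_mul_lt_iff₀ ht0]
      exact hz)
    have hzq : z = (1 - t) • p + t • q := by
      rw [hq, smul_add, smul_inv_smul₀ ht0.ne']
      module
    refine ⟨hzq ▸ hV hp hqV (by linarith) ht0.le (by ring), ?_⟩
    have hpx : ‖x₀ - p‖ < R := by
      have := hR hp
      rwa [Metric.mem_ball, dist_comm, dist_eq_norm] at this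
    rw [Metric.mem_ball, dist_eq_norm]
    calc ‖z - p‖ = ‖(z - (p + t • (x₀ - p))) + t • (x₀ - p)‖ := by congr 1; module
      _ ≤ ‖z - (p + t • (x₀ - p))‖ + ‖t • (x₀ - p)‖ := norm_add_le _ _
      _ = ‖z - (p + t • (x₀ - p))‖ + t * ‖x₀ - p‖ := by
        rw [norm_smul, Real.norm_of_nonneg ht0.le]
      _ < t * ρ + t * R := by gcongr
      _ = h := by rw [ht, hM]; field_simp; ring
  refine le_trans (le_of_eq ?_) (measure_mono hsub)
  rw [Measure.addHaar_ball_of_pos μ _ (by positivity),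
    ← ENNReal.ofReal_toReal (measure_ball_lt_top (μ := μ) (x := (0 : E)) (r := 1)).ne,
    ← ENNReal.ofReal_mul (by positivity), ← hm]
  congr 1
  rw [ht, mul_right_comm, ← mul_pow]
  congr 2
  field_simp

/-- Approximation of `f` on `V` by its averages on balls centred at the nearest point of a net. -/
lemma setLIntegral_enorm_sub_setAverage_le {V : Set E} (hVm : MeasurableSet V)
    (hb : Bornology.IsBounded V) {f : E → ℝ} (hf : Measurable f) (hi : IntegrableOn f V μ)
    {p : E → E} {h : ℝ} {a : ℝ≥0∞} (ha : a ≠ 0)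
    (hp : ∀ x ∈ V, dist (p x) x < h) (hpa : ∀ x ∈ V, a ≤ μ (V ∩ Metric.ball (p x) h)) :
    ∫⁻ x in V, ‖f x - ⨍ y in V ∩ Metric.ball (p x) h, f y ∂μ‖ₑ ∂μ ≤
      a⁻¹ * ∫⁻ z in nearPairs V (2 * h), ‖f z.1 - f z.2‖ₑ ∂(μ.prod μ) := by
  have hm : Measurable ((nearPairs V (2 * h)).indicator fun z : E × E => ‖f z.1 - f z.2‖ₑ) :=
    Measurable.indicator (by fun_prop) (measurableSet_nearPairs hVm _)
  rw [← lintegral_indicator (measurableSet_nearPairs hVm _), lintegral_prod _ hm.aemeasurable]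
  refine le_trans ?_ (mul_le_mul_right (setLIntegral_le_lintegral V _) _)
  rw [← lintegral_const_mul _ hm.lintegral_prod_right']
  refine setLIntegral_mono' hVm fun x hx => ?_
  have hSm : MeasurableSet (V ∩ Metric.ball (p x) h) := hVm.inter measurableSet_ball
  refine (enorm_sub_setAverage_le μ (S := V ∩ Metric.ball (p x) h)
    ((pos_iff_ne_zero.2 ha).trans_le (hpa x hx)).ne'
    (measure_ne_top_of_subset inter_subset_left hb.measure_lt_top.ne)
    (hi.mono_set inter_subset_left) (f x)).trans ?_
  refine mul_le_mul' (ENNReal.inv_le_inv.2 (hpa x hx)) ?_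
  · rw [← lintegral_indicator hSm]
    refine lintegral_mono fun y => ?_
    by_cases hy : y ∈ V ∩ Metric.ball (p x) h
    swap
    · simp [hy]
    rw [indicator_of_mem hy, indicator_of_mem]
    refine ⟨hx, hy.1, ?_⟩
    have h1 := hp x hx
    have h2 := Metric.mem_ball.1 hy.2
    calc dist x y ≤ dist x (p x) + dist (p x) y := dist_triangle _ _ _
      _ < 2 * h := by rw [dist_comm x, dist_comm (p x) y]; linarith

/-- A finite net of a bounded set, with a measurable choice of a nearby point of the net. -/
lemma exists_simpleFunc_net {V : Set E} (hb : Bornology.IsBounded V) (hne : V.Nonempty) {h : ℝ}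
    (hh : 0 < h) : ∃ (e : ℕ → E) (π : SimpleFunc E ℕ), (∀ i, e i ∈ V) ∧
      ∀ x ∈ V, dist (e (π x)) x < h := by
  obtain ⟨t, htV, htf, hcov⟩ := Metric.finite_approx_of_totallyBounded
    (hb.isCompact_closure.totallyBounded.subset subset_closure) h hh
  obtain ⟨n, f, -, hf⟩ := htf.fin_param
  obtain ⟨x₀, hx₀⟩ := hne
  obtain ⟨q, hq, -⟩ := mem_iUnion₂.1 (hcov hx₀)
  let e : ℕ → E := fun i => if hi : i < n then f ⟨i, hi⟩ else q
  refine ⟨e, SimpleFunc.nearestPtInd e n, fun i => htV ?_, fun x hx => ?_⟩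
  · by_cases hi : i < n
    · simp only [e, hi, dif_pos]
      exact hf ▸ mem_range_self _
    · simpa [e, hi] using hq
  · obtain ⟨q', hq', hd⟩ := mem_iUnion₂.1 (hcov hx)
    obtain ⟨⟨i, hi⟩, rfl⟩ : q' ∈ range f := hf ▸ hq'
    have h1 := SimpleFunc.edist_nearestPt_le e x (k := i) (N := n) hi.le
    have h2 : e i = f ⟨i, hi⟩ := by simp [e, hi]
    rw [h2, edist_dist, edist_dist, ENNReal.ofReal_le_ofReal_iff dist_nonneg] at h1
    rw [Metric.mem_ball, dist_comm] at hd
    exact h1.trans_lt hd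

/-- Compactness on a bounded convex open set. -/
theorem totallyBoundedL1_of_convex {V : Set E} (hVo : IsOpen V) (hV : Convex ℝ V)
    (hb : Bornology.IsBounded V) {u : ℕ → E → ℝ} (hum : ∀ n, Measurable (u n)) {l : ℕ → ℝ}
    (hl : ∀ n, 0 < l n) (hl0 : Tendsto l atTop (𝓝 0)) {C : ℝ≥0}
    (h1 : ∀ n, ∫⁻ x in V, ‖u n x‖ₑ ∂μ ≤ C)
    (h2 : ∀ n, ENNReal.ofReal (l n) *
      ∫⁻ z in (V ×ˢ V) ∩ jumpPairs (u n) (l n), singKernel z ∂(μ.prod μ) ≤ C) :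
    TotallyBoundedL1 (μ.restrict V) u := by
  rcases V.eq_empty_or_nonempty with rfl | hne
  · exact totallyBoundedL1_empty μ u
  have hi : ∀ n, IntegrableOn (u n) V μ := fun n =>
    ⟨(hum n).aestronglyMeasurable, (h1 n).trans_lt ENNReal.coe_lt_top⟩
  have hVf : IsFiniteMeasure (μ.restrict V) := ⟨by simpa using hb.measure_lt_top⟩
  obtain ⟨c, hc, h₀, hh₀, hdens⟩ := hV.exists_measure_inter_ball_ge μ hVo hb hne
  refine totallyBoundedL1_of_step hi fun ε hε => ?_
  set d := Module.finrank ℝ E with hd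
  -- The bounded quantity is 2 (2h)^{d+1} C / (c h^d): the Poincaré term divided by the minimal
  -- volume of the averaging sets.
  obtain ⟨h, hh, hhh₀, hhε⟩ : ∃ h : ℝ, 0 < h ∧ h ≤ h₀ ∧ 2 ^ (d + 2) * C * h / c ≤ ε / 2 := by
    refine ⟨min h₀ (ε * c / (2 ^ (d + 3) * (C + 1))), by positivity, min_le_left _ _, ?_⟩
    have : min h₀ (ε * c / (2 ^ (d + 3) * (C + 1))) ≤ ε * c / (2 ^ (d + 3) * (C + 1)) :=
      min_le_right _ _
    calc _ ≤ 2 ^ (d + 2) * C * (ε * c / (2 ^ (d + 3) * (C + 1))) / c := by gcongr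
      _ = ε / 2 * (C / (C + 1)) := by field_simp; ring
      _ ≤ ε / 2 * 1 := by
        gcongr
        rw [div_le_one (by positivity)]
        linarith
      _ = ε / 2 := mul_one _
  obtain ⟨e, π, heV, hπ⟩ := exists_simpleFunc_net hb hne hh
  set a : ℝ := c * h ^ d with ha
  have ha0 : 0 < a := by positivity
  have hfin : (μ.prod μ) (nearPairs V (2 * h)) ≠ ⊤ := by
    have hsub : nearPairs V (2 * h) ⊆ V ×ˢ V := fun z hz => ⟨hz.1, hz.2.1⟩
    refine measure_ne_top_of_subset hsub ?_
    rw [Measure.prod_prod]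
    exact ENNReal.mul_ne_top hb.measure_lt_top.ne hb.measure_lt_top.ne
  have hlim : Tendsto (fun n => (ENNReal.ofReal a)⁻¹ *
      (ENNReal.ofReal (l n) * (μ.prod μ) (nearPairs V (2 * h)))) atTop (𝓝 0) := by
    have t1 : Tendsto (fun n => ENNReal.ofReal (l n)) atTop (𝓝 0) := by
      simpa using ENNReal.tendsto_ofReal hl0
    have t2 := ENNReal.Tendsto.mul_const t1 (Or.inr hfin)
    have t3 := ENNReal.Tendsto.const_mul (a := (ENNReal.ofReal a)⁻¹) t2
      (Or.inr (by simpa using ha0))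
    simpa using t3
  -- With `h` fixed, the remaining Poincaré term vanishes because `l n` tends to 0.
  obtain ⟨N, hN⟩ := eventually_atTop.1 (hlim.eventually (ge_mem_nhds
    (show (0 : ℝ≥0∞) < ((ε / 2 : ℝ≥0) : ℝ≥0∞) by exact_mod_cast half_pos hε)))
  refine ⟨π, a⁻¹ * C, N, fun n i => ⨍ y in V ∩ Metric.ball (e i) h, u n y ∂μ,
    fun n i => ?_, fun n hn => ?_⟩
  · have hd' := hdens (e i) (heV i) h hh hhh₀
    have hft : μ (V ∩ Metric.ball (e i) h) ≠ ⊤ :=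
      measure_ne_top_of_subset inter_subset_left hb.measure_lt_top.ne
    have hle : a ≤ μ.real (V ∩ Metric.ball (e i) h) :=
      (ENNReal.ofReal_le_iff_le_toReal hft).1 hd'
    simp only [setAverage_eq]
    rw [smul_eq_mul, abs_mul, abs_of_nonneg (by positivity)]
    gcongr
    have h3 : ENNReal.ofReal |∫ y in V ∩ Metric.ball (e i) h, u n y ∂μ| ≤ C := by
      rw [← Real.enorm_eq_ofReal_abs]
      exact (enorm_integral_le_lintegral_enorm _).trans
        ((lintegral_mono_set inter_subset_left).trans (h1 n))
    rw [← ENNReal.ofReal_coe_nnreal] at h3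
    exact (ENNReal.ofReal_le_ofReal_iff C.2).1 h3
  · have k1 := setLIntegral_enorm_sub_setAverage_le μ hVo.measurableSet hb (hum n) (hi n)
      (p := fun x => e (π x)) (h := h) (a := ENNReal.ofReal a) (by simpa using ha0) hπ
      fun x _ => hdens _ (heV _) h hh hhh₀
    have k2 := setLIntegral_nearPairs_enorm_sub_le μ hVo.measurableSet hV (hum n) (hl n)
      (D := 2 * h) (by positivity)
    rw [← hd] at k2
    set W := ∫⁻ z in (V ×ˢ V) ∩ jumpPairs (u n) (l n), singKernel z ∂(μ.prod μ)
    calc _ ≤ _ := k1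
      _ ≤ (ENNReal.ofReal a)⁻¹ * (ENNReal.ofReal (l n) * ((μ.prod μ) (nearPairs V (2 * h)) +
          2 * ENNReal.ofReal (2 * h) ^ (d + 1) * W)) := by gcongr
      _ = (ENNReal.ofReal a)⁻¹ * (ENNReal.ofReal (l n) * (μ.prod μ) (nearPairs V (2 * h))) +
          (ENNReal.ofReal a)⁻¹ * (2 * ENNReal.ofReal (2 * h) ^ (d + 1) *
            (ENNReal.ofReal (l n) * W)) := by ring
      _ ≤ ((ε / 2 : ℝ≥0) : ℝ≥0∞) + (ENNReal.ofReal a)⁻¹ * (2 * ENNReal.ofReal (2 * h) ^ (d + 1) *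
            C) := by
        gcongr
        · exact hN n hn
        · exact h2 n
      _ ≤ ((ε / 2 : ℝ≥0) : ℝ≥0∞) + ((ε / 2 : ℝ≥0) : ℝ≥0∞) := by
        gcongr
        rw [← ENNReal.ofReal_inv_of_pos ha0, ← ENNReal.ofReal_coe_nnreal (p := C),
          ← ENNReal.ofReal_ofNat 2, ← ENNReal.ofReal_pow (by positivity),
          ← ENNReal.ofReal_mul (by norm_num), ← ENNReal.ofReal_mul (by positivity),
          ← ENNReal.ofReal_mul (by positivity), ← ENNReal.ofReal_coe_nnreal (p := ε / 2)]
        refine ENNReal.ofReal_le_ofReal (le_trans (le_of_eq ?_) hhε)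
        rw [ha]
        field_simp
        ring
      _ = ε := by rw [← ENNReal.coe_add, add_halves]

end Convex

/-! ### Transport by Lipschitz measure-preserving maps -/

section Transport

variable {E : Type*} [NormedAddCommGroup E] [NormedSpace ℝ E] [MeasurableSpace E] [BorelSpace E]
  [FiniteDimensional ℝ E] (μ : Measure E) [μ.IsAddHaarMeasure]

/-- Images are at most `K` times further apart. Injectivity is needed because the kernel vanishes on
the diagonal. -/
lemma singKernel_le_of_lipschitzOnWith {Φ : E → E} (hinj : Function.Injective Φ) {V : Set E}
    {K : ℝ≥0} (hK : LipschitzOnWith K Φ V) {z : E × E} (hz : z ∈ V ×ˢ V) :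
    singKernel z ≤ (K : ℝ≥0∞) ^ (Module.finrank ℝ E + 1) * singKernel (Φ z.1, Φ z.2) := by
  unfold singKernel
  rw [← ENNReal.coe_pow, ← ENNReal.coe_mul, ENNReal.coe_le_coe]
  by_cases h : z.1 = z.2
  · simp [h]
  have ha : 0 < ‖z.1 - z.2‖₊ := by simpa [sub_eq_zero] using h
  have hb : 0 < ‖Φ z.1 - Φ z.2‖₊ := by simpa [sub_eq_zero] using fun h' => h (hinj h')
  have hle : ‖Φ z.1 - Φ z.2‖₊ ≤ K * ‖z.1 - z.2‖₊ := by
    have := hK.dist_le_mul z.1 hz.1 z.2 hz.2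
    rw [dist_eq_norm, dist_eq_norm] at this
    exact_mod_cast this
  rw [inv_le_iff_one_le_mul₀ (by positivity), mul_right_comm, ← mul_pow, ← div_eq_mul_inv,
    one_le_div (by positivity)]
  gcongr

/-- Compactness on a bi-Lipschitz measure-preserving image of a bounded convex open set. -/
lemma totallyBoundedL1_image {Ω V : Set E} (hΩ : MeasurableSet Ω) (hVo : IsOpen V)
    (hV : Convex ℝ V) (hb : Bornology.IsBounded V) {Φ : E ≃ᵐ E} (hΦ : MeasurePreserving Φ μ μ)
    {K : ℝ≥0} (hK : LipschitzOnWith K Φ V) (hΦV : MapsTo Φ V Ω) {u : ℕ → E → ℝ}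
    (hum : ∀ n, Measurable (u n)) {l : ℕ → ℝ}
    (hl : ∀ n, 0 < l n) (hl0 : Tendsto l atTop (𝓝 0)) {C : ℝ≥0}
    (h1 : ∀ n, ∫⁻ x in Ω, ‖u n x‖ₑ ∂μ ≤ C)
    (h2 : ∀ n, ENNReal.ofReal (l n) *
      ∫⁻ z in (Ω ×ˢ Ω) ∩ jumpPairs (u n) (l n), singKernel z ∂(μ.prod μ) ≤ C) :
    TotallyBoundedL1 (μ.restrict (Φ '' V)) u := by
  set p := Module.finrank ℝ E + 1 with hp
  refine TotallyBoundedL1.of_comp hΦ (totallyBoundedL1_of_convex μ hVo hV hb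
    (fun n => (hum n).comp Φ.measurable) hl hl0 (C := C + K ^ p * C) (fun n => ?_) fun n => ?_)
  · calc ∫⁻ x in V, ‖u n (Φ x)‖ₑ ∂μ ≤ ∫⁻ x in Φ ⁻¹' Ω, ‖u n (Φ x)‖ₑ ∂μ :=
          lintegral_mono_set hΦV
      _ = ∫⁻ x in Ω, ‖u n x‖ₑ ∂μ :=
          hΦ.setLIntegral_comp_preimage hΩ (f := fun x => ‖u n x‖ₑ) (by fun_prop)
      _ ≤ C := h1 n
      _ ≤ _ := by
        push_cast
        exact le_self_add
  · have hm : MeasurableSet ((Ω ×ˢ Ω) ∩ jumpPairs (u n) (l n)) :=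
      (hΩ.prod hΩ).inter (measurableSet_jumpPairs (hum n) _)
    have hmV : MeasurableSet ((V ×ˢ V) ∩ jumpPairs (fun x => u n (Φ x)) (l n)) :=
      (hVo.measurableSet.prod hVo.measurableSet).inter
        (measurableSet_jumpPairs ((hum n).comp Φ.measurable) _)
    have hsub : (V ×ˢ V) ∩ jumpPairs (fun x => u n (Φ x)) (l n) ⊆
        Prod.map Φ Φ ⁻¹' ((Ω ×ˢ Ω) ∩ jumpPairs (u n) (l n)) :=
      fun z hz => ⟨⟨hΦV hz.1.1, hΦV hz.1.2⟩, hz.2⟩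
    have hmk : Measurable fun z : E × E => singKernel (Φ z.1, Φ z.2) :=
      measurable_singKernel.comp (by fun_prop)
    calc _ ≤ ENNReal.ofReal (l n) * ∫⁻ z in (V ×ˢ V) ∩ jumpPairs (fun x => u n (Φ x)) (l n),
          (K : ℝ≥0∞) ^ p * singKernel (Φ z.1, Φ z.2) ∂(μ.prod μ) := by
          gcongr 1
          exact setLIntegral_mono' hmV fun z hz =>
            singKernel_le_of_lipschitzOnWith Φ.injective hK hz.1
      _ = (K : ℝ≥0∞) ^ p * (ENNReal.ofReal (l n) *
          ∫⁻ z in (V ×ˢ V) ∩ jumpPairs (fun x => u n (Φ x)) (l n),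
            singKernel (Φ z.1, Φ z.2) ∂(μ.prod μ)) := by
          rw [lintegral_const_mul _ hmk]
          ring
      _ ≤ (K : ℝ≥0∞) ^ p * (ENNReal.ofReal (l n) *
          ∫⁻ z in Prod.map Φ Φ ⁻¹' ((Ω ×ˢ Ω) ∩ jumpPairs (u n) (l n)),
            singKernel (Prod.map Φ Φ z) ∂(μ.prod μ)) := by
          exact mul_le_mul_right (mul_le_mul_right (lintegral_mono_set hsub) _) _
      _ = (K : ℝ≥0∞) ^ p * (ENNReal.ofReal (l n) *
          ∫⁻ z in (Ω ×ˢ Ω) ∩ jumpPairs (u n) (l n), singKernel z ∂(μ.prod μ)) := by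
          rw [(hΦ.prod hΦ).setLIntegral_comp_preimage hm measurable_singKernel]
      _ ≤ (K : ℝ≥0∞) ^ p * C := by
          gcongr
          exact h2 n
      _ ≤ _ := by
        push_cast
        exact le_add_self

end Transport

/-! ### Shears flattening a graph -/

section Shear

variable {E : Type*} [NormedAddCommGroup E] [InnerProductSpace ℝ E]

/-- The shear `z ↦ z + γ(Πz) e`, with `Π` the orthogonal projection onto `e^⊥`. -/
def shear (e : E) (γ : E → ℝ) (z : E) : E := z + γ (z - inner ℝ e z • e) • e

lemma inner_shear {e : E} (he : ‖e‖ = 1) (γ : E → ℝ) (z : E) :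
    inner ℝ e (shear e γ z) = inner ℝ e z + γ (z - inner ℝ e z • e) := by
  simp [shear, inner_add_right, inner_smul_right, he]

lemma shear_sub_inner_smul {e : E} (he : ‖e‖ = 1) (γ : E → ℝ) (z : E) :
    shear e γ z - inner ℝ e (shear e γ z) • e = z - inner ℝ e z • e := by
  rw [inner_shear he, shear]
  module

lemma shear_neg_shear {e : E} (he : ‖e‖ = 1) (γ : E → ℝ) (z : E) :
    shear e (-γ) (shear e γ z) = z := by
  rw [shear, shear_sub_inner_smul he, shear]
  simp

lemma shear_shear_neg {e : E} (he : ‖e‖ = 1) (γ : E → ℝ) (z : E) :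
    shear e γ (shear e (-γ) z) = z := by
  simpa using shear_neg_shear he (-γ) z

lemma contDiff_shear (e : E) {γ : E → ℝ} {n : WithTop ℕ∞} (hγ : ContDiff ℝ n γ) :
    ContDiff ℝ n (shear e γ) := by
  have h : ContDiff ℝ n fun z : E => inner ℝ e z := contDiff_const.inner ℝ contDiff_id
  exact contDiff_id.add ((hγ.comp (contDiff_id.sub (h.smul contDiff_const))).smul contDiff_const)

variable [MeasurableSpace E] [BorelSpace E]

/-- A shear along a unit vector as a measurable equivalence. -/
def shearEquiv (e : E) (he : ‖e‖ = 1) (γ : E → ℝ) (hγ : Continuous γ) : E ≃ᵐ E where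
  toFun := shear e γ
  invFun := shear e (-γ)
  left_inv := shear_neg_shear he γ
  right_inv := shear_shear_neg he γ
  measurable_toFun :=
    (contDiff_zero.1 (contDiff_shear e (contDiff_zero (𝕜 := ℝ).2 hγ))).measurable
  measurable_invFun :=
    (contDiff_zero.1 (contDiff_shear e (contDiff_zero (𝕜 := ℝ).2 hγ.neg))).measurable

/-- The derivative is the identity plus a rank-one map with range in the line of `e` and vanishing
on `e`: a transvection, of determinant 1. The shear is also bijective, so the change of variables
formula applies. -/
lemma measurePreserving_shear [FiniteDimensional ℝ E] (μ : Measure E) [μ.IsAddHaarMeasure]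
    {e : E} (he : ‖e‖ = 1) {γ : E → ℝ} (hγ : ContDiff ℝ 1 γ) :
    MeasurePreserving (shear e γ) μ μ := by
  let P : E →L[ℝ] E := ContinuousLinearMap.id ℝ E - (innerSL ℝ e).smulRight e
  have hP : ∀ z, P z = z - inner ℝ e z • e := fun z => by simp [P]
  let f' : E → E →L[ℝ] E := fun z =>
    ContinuousLinearMap.id ℝ E + ((fderiv ℝ γ (P z)).comp P).smulRight e
  have hd : ∀ z, HasFDerivAt (shear e γ) (f' z) z := fun z => by
    have h1 : HasFDerivAt γ (fderiv ℝ γ (P z)) (P z) :=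
      (hγ.differentiable one_ne_zero (P z)).hasFDerivAt
    have h2 := (hasFDerivAt_id z).add ((h1.comp z P.hasFDerivAt).smul_const e)
    refine h2.congr_of_eventuallyEq (Eventually.of_forall fun w => ?_)
    simp [shear, hP]
  have hdet : ∀ z, (f' z).det = 1 := fun z => by
    have : ((f' z : E →L[ℝ] E) : E →ₗ[ℝ] E) =
        LinearMap.transvection (((fderiv ℝ γ (P z)).comp P : E →L[ℝ] ℝ) : E →ₗ[ℝ] ℝ) e := by
      ext w
      simp [f', LinearMap.transvection.apply]
    rw [ContinuousLinearMap.det, this, LinearMap.transvection.det]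
    have : P e = 0 := by simp [hP, he]
    simp [this]
  have hm : Measurable (shear e γ) := (contDiff_shear e hγ).continuous.measurable
  refine ⟨hm, ?_⟩
  have h := map_withDensity_abs_det_fderiv_eq_addHaar μ nullMeasurableSet_univ
    (fun z _ => (hd z).hasFDerivWithinAt) ((Function.LeftInverse.injective
      (shear_neg_shear he γ)).injOn (s := univ))
  have hs : Function.Surjective (shear e γ) := fun z => ⟨_, shear_shear_neg he γ z⟩
  simpa [hdet, image_univ, hs.range_eq] using h

end Shear

/-! ### Smooth bounded domains by localization -/

section Domain

variable {d : ℕ}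

lemma IsSmoothOpen.exists_nhds_totallyBoundedL1 {Ω : Set (EuclideanSpace ℝ (Fin d))}
    (hΩ : IsSmoothOpen Ω) {u : ℕ → EuclideanSpace ℝ (Fin d) → ℝ}
    (hum : ∀ n, Measurable (u n)) {l : ℕ → ℝ}
    (hl : ∀ n, 0 < l n) (hl0 : Tendsto l atTop (𝓝 0)) {C : ℝ≥0}
    (h1 : ∀ n, ∫⁻ x in Ω, ‖u n x‖ₑ ≤ C)
    (h2 : ∀ n, ENNReal.ofReal (l n) *
      ∫⁻ z in (Ω ×ˢ Ω) ∩ jumpPairs (u n) (l n), singKernel z ∂(volume.prod volume) ≤ C)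
    {x₀ : EuclideanSpace ℝ (Fin d)} (hx₀ : x₀ ∈ closure Ω) :
    ∃ U, IsOpen U ∧ x₀ ∈ U ∧ TotallyBoundedL1 (volume.restrict (U ∩ Ω)) u := by
  by_cases hx : x₀ ∈ Ω
  · obtain ⟨r, hr, hball⟩ := Metric.isOpen_iff.1 hΩ.isOpen x₀ hx
    refine ⟨Metric.ball x₀ r, Metric.isOpen_ball, Metric.mem_ball_self hr, ?_⟩
    have := totallyBoundedL1_image volume hΩ.isOpen.measurableSet Metric.isOpen_ball
      (convex_ball x₀ r) Metric.isBounded_ball (Φ := MeasurableEquiv.refl _)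
      (MeasurePreserving.id volume) (K := 1) (LipschitzWith.id.lipschitzOnWith) hball hum hl hl0
      h1 h2
    refine this.mono ?_
    simp
  · have hfr : x₀ ∈ frontier Ω := ⟨hx₀, by rwa [hΩ.isOpen.interior_eq]⟩
    obtain ⟨r, hr, e, γ, he, hγ, hgr⟩ := hΩ.graph x₀ hfr
    have hγ1 : ContDiff ℝ 1 γ := hγ.of_le (by exact_mod_cast le_top)
    have hΦ1 := contDiff_shear e hγ1
    let Φ := shearEquiv e he γ hγ1.continuous
    set y₀ := shear e (-γ) x₀ with hy₀
    have hxy : shear e γ y₀ = x₀ := shear_shear_neg he γ x₀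
    obtain ⟨K, t, ht, hK⟩ := hΦ1.locallyLipschitz y₀
    have hpre : shear e γ ⁻¹' Metric.ball x₀ r ∈ 𝓝 y₀ :=
      hΦ1.continuous.continuousAt.preimage_mem_nhds (by rw [hxy]; exact Metric.ball_mem_nhds _ hr)
    obtain ⟨ρ, hρ, hball⟩ := Metric.mem_nhds_iff.1 (inter_mem ht hpre)
    -- In sheared coordinates Ω is, near `y₀`, the half-space above `e^⊥`, so a small half-ball is a
    -- convex model. The radius `ρ` ensures both the Lipschitz bound and the graph description.
    let V : Set (EuclideanSpace ℝ (Fin d)) := Metric.ball y₀ ρ ∩ {z | 0 < inner ℝ e z}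
    have hVo : IsOpen V := Metric.isOpen_ball.inter
      (isOpen_lt continuous_const (continuous_const.inner continuous_id))
    have hVc : Convex ℝ V := (convex_ball y₀ ρ).inter
      (convex_halfSpace_gt (innerSL ℝ e).toLinearMap.isLinear 0)
    have hiff : ∀ z ∈ Metric.ball y₀ ρ, shear e γ z ∈ Ω ↔ 0 < inner ℝ e z := fun z hz => by
      rw [hgr _ (hball hz).2, shear_sub_inner_smul he, inner_shear he]
      constructor <;> intro <;> linarith
    have hΦmp : MeasurePreserving Φ volume volume := measurePreserving_shear volume he hγ1
    have hΦK : LipschitzOnWith K Φ V := hK.mono fun z hz => (hball hz.1).1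
    have hΦV : MapsTo Φ V Ω := fun z hz => (hiff z hz.1).2 hz.2
    have hTB := totallyBoundedL1_image volume hΩ.isOpen.measurableSet hVo hVc
      (Metric.isBounded_ball.subset inter_subset_left) hΦmp hΦK hΦV hum hl hl0 h1 h2
    have hΨc : Continuous (shear e (-γ)) := (contDiff_shear e hγ1.neg).continuous
    have hmem : shear e (-γ) x₀ ∈ Metric.ball y₀ ρ := by
      rw [← hy₀]
      exact Metric.mem_ball_self hρ
    refine ⟨shear e (-γ) ⁻¹' Metric.ball y₀ ρ, Metric.isOpen_ball.preimage hΨc, hmem,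
      hTB.mono ?_⟩
    rintro z ⟨hz, hzΩ⟩
    have hz' : shear e γ (shear e (-γ) z) = z := shear_shear_neg he γ z
    exact ⟨shear e (-γ) z, ⟨hz, (hiff _ hz).1 (by rwa [hz'])⟩, hz'⟩

lemma IsSmoothOpen.totallyBoundedL1 {Ω : Set (EuclideanSpace ℝ (Fin d))}
    (hΩ : IsSmoothOpen Ω) (hb : Bornology.IsBounded Ω) {u : ℕ → EuclideanSpace ℝ (Fin d) → ℝ}
    (hum : ∀ n, Measurable (u n)) {l : ℕ → ℝ}
    (hl : ∀ n, 0 < l n) (hl0 : Tendsto l atTop (𝓝 0)) {C : ℝ≥0}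
    (h1 : ∀ n, ∫⁻ x in Ω, ‖u n x‖ₑ ≤ C)
    (h2 : ∀ n, ENNReal.ofReal (l n) *
      ∫⁻ z in (Ω ×ˢ Ω) ∩ jumpPairs (u n) (l n), singKernel z ∂(volume.prod volume) ≤ C) :
    TotallyBoundedL1 (volume.restrict Ω) u := by
  choose! U hUo hxU hU using fun x (hx : x ∈ closure Ω) =>
    hΩ.exists_nhds_totallyBoundedL1 hum hl hl0 h1 h2 hx
  obtain ⟨t, ht, hcov⟩ := hb.isCompact_closure.elim_nhds_subcover U
    fun x hx => (hUo x hx).mem_nhds (hxU x hx)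
  refine (totallyBoundedL1_biUnion t
    (fun x hx => ((hUo x (ht x hx)).inter hΩ.isOpen).measurableSet)
    fun x hx => hU x (ht x hx)).mono fun z hz => ?_
  obtain ⟨x, hx, hzx⟩ := mem_iUnion₂.1 (hcov (subset_closure hz))
  exact mem_iUnion₂.2 ⟨x, hx, hzx, hz⟩

end Domain

/-! ### The whole space through a decaying weight -/

section WholeSpace

variable {E : Type*} [NormedAddCommGroup E] [MeasurableSpace E] [BorelSpace E]

/-- A weight decaying at infinity. -/
noncomputable def decayWeight (x : E) : ℝ≥0∞ := (1 + ‖x‖ₑ)⁻¹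

lemma measurable_decayWeight : Measurable (decayWeight : E → ℝ≥0∞) := by
  unfold decayWeight
  fun_prop

lemma decayWeight_ne_zero (x : E) : decayWeight x ≠ 0 := by
  simp [decayWeight]

lemma withDensity_decayWeight_le (μ : Measure E) : μ.withDensity decayWeight ≤ μ := by
  calc μ.withDensity decayWeight ≤ μ.withDensity 1 :=
        withDensity_mono (Eventually.of_forall fun x => by simp [decayWeight])
    _ = μ := withDensity_one

lemma restrict_closedBall_le_withDensity_decayWeight (μ : Measure E) (R : ℝ≥0) :
    μ.restrict (Metric.closedBall 0 R) ≤ ((1 + R : ℝ≥0) : ℝ≥0∞) • μ.withDensity decayWeight := by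
  refine Measure.le_iff.2 fun s hs => ?_
  have hm : MeasurableSet (s ∩ Metric.closedBall 0 R) := hs.inter measurableSet_closedBall
  rw [Measure.restrict_apply hs, Measure.smul_apply, smul_eq_mul, withDensity_apply _ hs,
    ← lintegral_const_mul _ measurable_decayWeight, ← setLIntegral_one]
  refine le_trans (setLIntegral_mono' hm fun x hx => ?_) (lintegral_mono_set inter_subset_left)
  have hx' : 1 + ‖x‖ₑ ≤ ((1 + R : ℝ≥0) : ℝ≥0∞) := by
    have : ‖x‖₊ ≤ R := by simpa [← NNReal.coe_le_coe] using hx.2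
    push_cast
    gcongr
    exact_mod_cast this
  calc (1 : ℝ≥0∞) = (1 + ‖x‖ₑ) * (1 + ‖x‖ₑ)⁻¹ :=
        (ENNReal.mul_inv_cancel (by simp) (by finiteness)).symm
    _ ≤ _ := by
      unfold decayWeight
      gcongr

/-- Local total boundedness together with a bound in `L¹` gives total boundedness for the measure
with a decaying weight. -/
lemma totallyBoundedL1_withDensity_decayWeight {μ : Measure E} {u : ℕ → E → ℝ}
    (hum : ∀ n, Measurable (u n)) {C : ℝ≥0} (h1 : ∀ n, ∫⁻ x, ‖u n x‖ₑ ∂μ ≤ C)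
    (hloc : ∀ R : ℝ, TotallyBoundedL1 (μ.restrict (Metric.ball 0 R)) u) :
    TotallyBoundedL1 (μ.withDensity decayWeight) u := by
  intro ε hε
  -- Outside the ball of radius `R` the weight is at most 1/R, so the weighted tail is at most C/R.
  obtain ⟨R, hR0, hR⟩ : ∃ R : ℝ≥0, 0 < R ∧ R⁻¹ * C ≤ ε / 2 := by
    refine ⟨2 * (C + 1) / ε, by positivity, ?_⟩
    rw [inv_div, div_mul_eq_mul_div, div_le_div_iff₀ (by positivity) (by positivity)]
    calc ε * C * 2 = ε * (2 * C) := by ring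
      _ ≤ ε * (2 * (C + 1)) := by gcongr; exact le_self_add
  set B := Metric.ball (0 : E) R
  have hB : MeasurableSet B := measurableSet_ball
  obtain ⟨F, hF, hFi, hFu⟩ := hloc R (ε / 2) (by positivity)
  refine ⟨B.indicator '' F, hF.image _, ?_, fun n => ?_⟩
  · rintro _ ⟨g, hg, rfl⟩
    exact ((integrable_indicator_iff hB).2 (hFi g hg)).mono_measure (withDensity_decayWeight_le μ)
  obtain ⟨g, hg, hn⟩ := hFu n
  refine ⟨_, mem_image_of_mem _ hg, ?_⟩
  rw [← lintegral_add_compl _ hB]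
  have t1 : ∫⁻ x in B, ‖u n x - B.indicator g x‖ₑ ∂(μ.withDensity decayWeight) ≤
      ((ε / 2 : ℝ≥0) : ℝ≥0∞) := by
    rw [setLIntegral_congr_fun (g := fun x => ‖u n x - g x‖ₑ) hB
      fun x hx => by simp only [indicator_of_mem hx]]
    exact (lintegral_mono' (Measure.restrict_mono le_rfl (withDensity_decayWeight_le μ))
      le_rfl).trans hn
  have t2 : ∫⁻ x in Bᶜ, ‖u n x - B.indicator g x‖ₑ ∂(μ.withDensity decayWeight) ≤
      ((ε / 2 : ℝ≥0) : ℝ≥0∞) := by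
    rw [setLIntegral_congr_fun (g := fun x => ‖u n x‖ₑ) hB.compl
      fun x hx => by simp only [indicator_of_notMem hx, sub_zero],
      setLIntegral_withDensity_eq_setLIntegral_mul _ measurable_decayWeight
        (by fun_prop) hB.compl]
    calc _ ≤ ∫⁻ x in Bᶜ, ((R⁻¹ : ℝ≥0) : ℝ≥0∞) * ‖u n x‖ₑ ∂μ := by
          refine setLIntegral_mono' hB.compl fun x hx => ?_
          rw [Pi.mul_apply]
          gcongr
          rw [decayWeight, ENNReal.coe_inv hR0.ne', ENNReal.inv_le_inv]
          have : R ≤ ‖x‖₊ := by simpa [B, ← NNReal.coe_le_coe] using hx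
          refine le_trans ?_ le_add_self
          rw [enorm_eq_nnnorm]
          exact_mod_cast this
      _ = ((R⁻¹ : ℝ≥0) : ℝ≥0∞) * ∫⁻ x in Bᶜ, ‖u n x‖ₑ ∂μ :=
          lintegral_const_mul _ (by fun_prop)
      _ ≤ ((R⁻¹ : ℝ≥0) : ℝ≥0∞) * C := by
          gcongr
          exact (setLIntegral_le_lintegral _ _).trans (h1 n)
      _ ≤ _ := by exact_mod_cast hR
  calc _ ≤ ((ε / 2 : ℝ≥0) : ℝ≥0∞) + ((ε / 2 : ℝ≥0) : ℝ≥0∞) := add_le_add t1 t2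
    _ = ε := by rw [← ENNReal.coe_add, add_halves]

lemma exists_subseq_of_locally_totallyBoundedL1 {μ : Measure E} {u : ℕ → E → ℝ}
    (hum : ∀ n, Measurable (u n)) {C : ℝ≥0} (h1 : ∀ n, ∫⁻ x, ‖u n x‖ₑ ∂μ ≤ C)
    (hloc : ∀ R : ℝ, TotallyBoundedL1 (μ.restrict (Metric.ball 0 R)) u) :
    ∃ (k : ℕ → ℕ) (v : E → ℝ), StrictMono k ∧ Integrable v μ ∧
      ∀ K : Set E, IsCompact K → Tendsto (fun j => ∫⁻ x in K, ‖u (k j) x - v x‖ₑ ∂μ) atTop (𝓝 0) := by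
  have hi : ∀ n, Integrable (u n) μ := fun n =>
    ⟨(hum n).aestronglyMeasurable, (h1 n).trans_lt ENNReal.coe_lt_top⟩
  obtain ⟨k, v, hk, hv, hlim⟩ :=
    (totallyBoundedL1_withDensity_decayWeight hum h1 hloc).exists_subseq
      fun n => (hi n).mono_measure (withDensity_decayWeight_le μ)
  have hball : ∀ R : ℝ≥0, Tendsto (fun j => ∫⁻ x in Metric.closedBall 0 R,
      ‖u (k j) x - v x‖ₑ ∂μ) atTop (𝓝 0) := fun R => by
    refine tendsto_of_tendsto_of_tendsto_of_le_of_le tendsto_const_nhds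
      (h := fun j => ((1 + R : ℝ≥0) : ℝ≥0∞) *
        ∫⁻ x, ‖u (k j) x - v x‖ₑ ∂(μ.withDensity decayWeight)) ?_ (fun _ => zero_le) fun j => ?_
    · simpa using ENNReal.Tendsto.const_mul (a := ((1 + R : ℝ≥0) : ℝ≥0∞)) hlim
        (Or.inr ENNReal.coe_ne_top)
    · refine (lintegral_mono' (restrict_closedBall_le_withDensity_decayWeight μ R)
        le_rfl).trans ?_
      rw [lintegral_smul_measure, smul_eq_mul]
  refine ⟨k, v, hk, ?_, fun K hK => ?_⟩
  -- The limit is so far only weighted-integrable. Measurability passes to `μ` as the weight never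
  -- vanishes; the L¹ bound passes to the limit on each ball, then to the increasing union.
  · have hac : μ ≪ μ.withDensity decayWeight :=
      withDensity_absolutelyContinuous' measurable_decayWeight.aemeasurable
        (Eventually.of_forall decayWeight_ne_zero)
    have hvm : AEStronglyMeasurable v μ := hv.1.mono_ac hac
    refine ⟨hvm, lt_of_le_of_lt ?_ (ENNReal.coe_lt_top (r := C))⟩
    have hbd : ∀ n : ℕ, ∫⁻ x in Metric.closedBall 0 n, ‖v x‖ₑ ∂μ ≤ C := fun n => by
      have hl := (hball n).add_const (C : ℝ≥0∞)
      rw [zero_add] at hl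
      refine ge_of_tendsto' hl fun j => ?_
      calc ∫⁻ x in Metric.closedBall 0 (n : ℝ), ‖v x‖ₑ ∂μ
          ≤ ∫⁻ x in Metric.closedBall 0 (n : ℝ), (‖u (k j) x - v x‖ₑ + ‖u (k j) x‖ₑ) ∂μ := by
            refine lintegral_mono fun x => ?_
            calc ‖v x‖ₑ = ‖-(u (k j) x - v x) + u (k j) x‖ₑ := by congr 1; ring
              _ ≤ _ := (enorm_add_le _ _).trans (by rw [enorm_neg])
        _ = _ := lintegral_add_right _ (by have := hum (k j); fun_prop)
        _ ≤ _ := by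
            gcongr
            · simp
            · exact (setLIntegral_le_lintegral _ _).trans (h1 _)
    have hun : (⋃ n : ℕ, Metric.closedBall (0 : E) n) = univ :=
      Metric.iUnion_closedBall_nat 0
    rw [← setLIntegral_univ, ← hun, setLIntegral_iUnion_of_directed]
    · exact iSup_le hbd
    · exact Monotone.directed_le fun a b hab =>
        Metric.closedBall_subset_closedBall (by exact_mod_cast hab)
  · obtain ⟨R, hR⟩ := hK.isBounded.subset_closedBall 0
    refine tendsto_of_tendsto_of_tendsto_of_le_of_le tendsto_const_nhds (hball R.toNNReal)
      (fun _ => zero_le) fun j => lintegral_mono_set (hR.trans ?_)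
    exact Metric.closedBall_subset_closedBall (Real.le_coe_toNNReal R)

end WholeSpace

/-! ### From the functional to the jump energy -/

section Functional

variable {d : ℕ}

/-- Only the normalization rules out φ = 0. -/
lemma ClassA.exists_pos {φ : ℝ≥0 → ℝ≥0} (hφ : ClassA d φ) : ∃ t, 0 < t ∧ 0 < φ t := by
  by_contra! h
  obtain ⟨e, he⟩ := hφ.normalized
  have h0 : ∀ t, φ t = 0 := fun t => by
    rcases (zero_le (a := t)).eq_or_lt with rfl | ht
    · exact hφ.map_zero
    · exact le_antisymm (h t ht) zero_le
  simp [h0] at he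

lemma Lam_congr_ae {φ : ℝ≥0 → ℝ≥0} {Ω : Set (EuclideanSpace ℝ (Fin d))}
    {u v : EuclideanSpace ℝ (Fin d) → ℝ} (h : u =ᵐ[volume.restrict Ω] v) :
    Lam φ Ω u = Lam φ Ω v := by
  refine lintegral_congr_ae ?_
  filter_upwards [h] with y hy
  refine lintegral_congr_ae ?_
  filter_upwards [h] with x hx
  rw [hx, hy]

/-- A Chebyshev-type bound: where u varies by at least tδ, monotonicity bounds the numerator below
by `φ t`. -/
lemma mul_setLIntegral_jumpPairs_le_Lam {φ : ℝ≥0 → ℝ≥0} (hφ : Monotone φ) (t : ℝ≥0)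
    {Ω : Set (EuclideanSpace ℝ (Fin d))}
    {u : EuclideanSpace ℝ (Fin d) → ℝ} (hu : Measurable u) {δ : ℝ} (hδ : 0 < δ) :
    φ t * ∫⁻ z in (Ω ×ˢ Ω) ∩ jumpPairs u (t * δ), singKernel z ∂(volume.prod volume) ≤
      Lam φ Ω fun x => u x / δ := by
  have hJ := measurableSet_jumpPairs hu (t * δ)
  have hm : Measurable ((jumpPairs u (t * δ)).indicator
      (singKernel (E := EuclideanSpace ℝ (Fin d)))) := measurable_singKernel.indicator hJ
  rw [inter_comm, ← Measure.restrict_restrict hJ, ← lintegral_indicator hJ,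
    ← Measure.prod_restrict, lintegral_prod_symm _ hm.aemeasurable,
    ← lintegral_const_mul _ hm.lintegral_prod_left']
  refine lintegral_mono fun y => ?_
  rw [← lintegral_const_mul _ (hm.of_uncurry_right (f := fun x y =>
    (jumpPairs u (t * δ)).indicator singKernel (x, y)))]
  refine lintegral_mono fun x => ?_
  by_cases h : (x, y) ∈ jumpPairs u (t * δ)
  swap
  · simp [h]
  rw [indicator_of_mem h, singKernel, finrank_euclideanSpace_fin, ← ENNReal.coe_mul,
    ENNReal.coe_le_coe, div_eq_mul_inv]
  gcongr
  refine hφ ?_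
  rw [← NNReal.coe_le_coe, coe_nnnorm, ← sub_div, norm_div, Real.norm_of_nonneg hδ.le,
    le_div_iff₀ hδ]
  exact h

end Functional

/-! ### Compactness theorem -/

theorem theorem3 (d : ℕ) (hd : 1 ≤ d) (Ω : Set (EuclideanSpace ℝ (Fin d)))
    (hΩ : (Bornology.IsBounded Ω ∧ IsSmoothOpen Ω) ∨ Ω = Set.univ)
    (φ : ℝ≥0 → ℝ≥0) (hφ : ClassA d φ)
    (δ : ℕ → ℝ) (hδ_pos : ∀ n, 0 < δ n) (hδ : Tendsto δ atTop (𝓝 0))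
    (u : ℕ → EuclideanSpace ℝ (Fin d) → ℝ) (hu : ∀ n, IntegrableOn (u n) Ω)
    (hu_bdd : ∃ C : ℝ, ∀ n, ∫ x in Ω, |u n x| ≤ C)
    (hΛ : ⨆ n, LamDelta φ Ω (δ n) (u n) < ⊤) :
    ∃ (k : ℕ → ℕ) (v : EuclideanSpace ℝ (Fin d) → ℝ),
      StrictMono k ∧ IntegrableOn v Ω ∧
      (Bornology.IsBounded Ω →
        Tendsto (fun j => ∫⁻ x in Ω, ‖u (k j) x - v x‖ₑ) atTop (𝓝 0)) ∧
      (Ω = Set.univ → ∀ K : Set (EuclideanSpace ℝ (Fin d)), IsCompact K →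
        Tendsto (fun j => ∫⁻ x in K, ‖u (k j) x - v x‖ₑ) atTop (𝓝 0)) := by
  have hΩm : MeasurableSet Ω := by
    rcases hΩ with ⟨-, h⟩ | rfl
    · exact h.isOpen.measurableSet
    · exact MeasurableSet.univ
  -- Measurable representatives: the bisection argument needs measurability everywhere, and neither
  -- the functional nor the L¹ distances see the change.
  let w : ℕ → EuclideanSpace ℝ (Fin d) → ℝ := fun n => (hu n).1.mk (u n)
  have hwm : ∀ n, Measurable (w n) := fun n => (hu n).1.stronglyMeasurable_mk.measurable
  have huw : ∀ n, u n =ᵐ[volume.restrict Ω] w n := fun n => (hu n).1.ae_eq_mk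
  have hwi : ∀ n, IntegrableOn (w n) Ω := fun n => (hu n).congr (huw n)
  obtain ⟨t, ht, hφt⟩ := hφ.exists_pos
  obtain ⟨C₁, hC₁⟩ := hu_bdd
  set S := (⨆ n, LamDelta φ Ω (δ n) (u n)).toNNReal with hS
  have hlam : ∀ n, LamDelta φ Ω (δ n) (w n) ≤ S := fun n => by
    have : LamDelta φ Ω (δ n) (w n) = LamDelta φ Ω (δ n) (u n) := by
      unfold LamDelta
      rw [Lam_congr_ae]
      filter_upwards [huw n] with x hx
      rw [hx]
    rw [this, hS, ENNReal.coe_toNNReal hΛ.ne]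
    exact le_iSup (fun n => LamDelta φ Ω (δ n) (u n)) n
  -- A common bound: the first summand serves the L¹ norms, the second the jump energies.
  set C : ℝ≥0 := C₁.toNNReal + t / φ t * S with hC
  have h1 : ∀ n, ∫⁻ x in Ω, ‖w n x‖ₑ ≤ C := fun n => by
    have hn : ∫⁻ x in Ω, ‖w n x‖ₑ = ∫⁻ x in Ω, ‖u n x‖ₑ :=
      lintegral_congr_ae ((huw n).symm.fun_comp fun y : ℝ => ‖y‖ₑ)
    rw [hn, ← ofReal_integral_norm_eq_lintegral_enorm (hu n)]
    refine (ENNReal.ofReal_le_ofReal (hC₁ n)).trans ?_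
    rw [hC, ENNReal.coe_add]
    exact le_self_add
  have h2 : ∀ n, ENNReal.ofReal (t * δ n) *
      ∫⁻ z in (Ω ×ˢ Ω) ∩ jumpPairs (w n) (t * δ n), singKernel z ∂(volume.prod volume) ≤ C :=
    fun n => by
    have hk := mul_setLIntegral_jumpPairs_le_Lam (Ω := Ω) hφ.monotone t (hwm n) (hδ_pos n)
    set W := ∫⁻ z in (Ω ×ˢ Ω) ∩ jumpPairs (w n) (t * δ n), singKernel z ∂(volume.prod volume)
    have hc : ((t / φ t : ℝ≥0) : ℝ≥0∞) * φ t = t := by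
      rw [← ENNReal.coe_mul, div_mul_cancel₀ _ hφt.ne']
    calc ENNReal.ofReal (t * δ n) * W
        = ((t / φ t : ℝ≥0) : ℝ≥0∞) * (ENNReal.ofReal (δ n) * (φ t * W)) := by
          rw [ENNReal.ofReal_mul t.coe_nonneg, ENNReal.ofReal_coe_nnreal, ← hc]
          ring
      _ ≤ ((t / φ t : ℝ≥0) : ℝ≥0∞) * S := by
          gcongr
          refine le_trans ?_ (hlam n)
          unfold LamDelta
          gcongr
      _ ≤ C := by
          rw [hC, ENNReal.coe_add, ENNReal.coe_mul]
          exact le_add_self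
  have hl : ∀ n, 0 < t * δ n := fun n => mul_pos ht (hδ_pos n)
  have hl0 : Tendsto (fun n => t * δ n) atTop (𝓝 0) := by simpa using hδ.const_mul (t : ℝ)
  -- As d ≥ 1 the whole space is unbounded, so in each case one of the two convergence clauses is
  -- vacuous.
  have : Nonempty (Fin d) := ⟨⟨0, hd⟩⟩
  have hnb : ¬ Bornology.IsBounded (univ : Set (EuclideanSpace ℝ (Fin d))) :=
    NormedSpace.unbounded_univ ℝ _
  rcases hΩ with ⟨hb, hΩ⟩ | rfl
  · obtain ⟨k, v, hk, hv, hlim⟩ :=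
      (hΩ.totallyBoundedL1 hb hwm hl hl0 h1 h2).exists_subseq hwi
    refine ⟨k, v, hk, hv, fun _ => hlim.congr fun j => ?_, fun h => absurd (h ▸ hb) hnb⟩
    refine lintegral_congr_ae ?_
    filter_upwards [huw (k j)] with x hx
    rw [hx]
  · have hloc : ∀ R : ℝ, TotallyBoundedL1
        (volume.restrict (Metric.ball (0 : EuclideanSpace ℝ (Fin d)) R)) w := fun R => by
      refine totallyBoundedL1_of_convex volume Metric.isOpen_ball (convex_ball 0 R)
        Metric.isBounded_ball hwm hl hl0 (C := C)
        (fun n => (lintegral_mono_set (subset_univ _)).trans (h1 n)) fun n => ?_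
      refine le_trans ?_ (h2 n)
      gcongr <;> exact subset_univ _
    obtain ⟨k, v, hk, hv, hlim⟩ := exists_subseq_of_locally_totallyBoundedL1 hwm
      (C := C) (fun n => by simpa using h1 n) hloc
    refine ⟨k, v, hk, hv.integrableOn, fun h => absurd h hnb, fun _ K hK =>
      (hlim K hK).congr fun j => ?_⟩
    refine lintegral_congr_ae (ae_restrict_of_ae ?_)
    have := huw (k j)
    rw [Measure.restrict_univ] at this
    filter_upwards [this] with x hx
    rw [hx]
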